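/- Let $m\ge r\ge 2$ and $k\ge 1$ be integers with $k\mid (r-1)$, let $N=2^m$ and $p\in(0,\tfrac12)$. Let $\mathrm{RM}(m,r)\subseteq\{0,1\}^N$ be the binary Reed--Muller code of evaluation vectors $(f(\mathbf z))_{\mathbf z\in\mathbb F_2^m}$ of polynomials $f\in\mathbb F_2[x_1,\dots,x_m]$ with $\deg f\le r$. The Recursive Projection-Aggregation (RPA) decoder with $k$-dimensional subspaces and at most $M_{\mathrm{iter}}\ge 1$ iterations is defined as follows. For $\mathbf Y\in\{0,1\}^{2^m}$ and a $k$-dimensional subspace $\mathbb B$ of $\mathbb F_2^m$, the projection $\mathbf Y_{/\mathbb B}$ has, for each coset $T$ of $\mathbb B$, the coordinate $Y_{/\mathbb B}(T)=\bigoplus_{\mathbf x\in T}Y_{\mathbf x}$; the cosets are indexed by $\mathbb F_2^{m-k}$ through a fixed (arbitrary) linear isomorphism $\mathbb F_2^m/\mathbb B\cong\mathbb F_2^{m-k}$. One iteration at order $r$ decodes every $\mathbf Y_{/\mathbb B}$ to some $\widehat{\mathbf Y}_{/\mathbb B}$, recursively by the RPA decoder of order $r-k$ on length $2^{m-k}$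 (with the same $k$ and $M_{\mathrm{iter}}$) if $r\ne k+1$, and by a maximum likelihood (minimum Hamming distance) decoder for $\mathrm{RM}(m-k,1)$, with ties broken by an arbitrary fixed rule, if $r=k+1$; it then replaces $\mathbf Y$ by $\overline{\mathbf Y}$, where $\overline Y_{\mathbf x}=Y_{\mathbf x}\oplus 1$ if $Y_{/\mathbb B}(\mathbf x+\mathbb B)\ne\widehat Y_{/\mathbb B}(\mathbf x+\mathbb B)$ for more than half of all $k$-dimensional subspaces $\mathbb B$ of $\mathbb F_2^m$, and $\overline Y_{\mathbf x}=Y_{\mathbf x}$ otherwise. The iteration is repeated up to $M_{\mathrm{iter}}$ times, stopping early if $\overline{\mathbf Y}=\mathbf Y$, and the final vector is returned. Let $P_{\mathrm{err}}(\mathrm{RM}(m,r))$ be the probability that the RPA decoder, applied to $\mathbf C\oplus\boldsymbol\nu$, does not return $\mathbf C$, where $\mathbf C$ is uniform on $\mathrm{RM}(m,r)$ and $\boldsymbol\nu$ is independent of $\mathbf C$ with i.i.d. $\mathrm{Ber}(p)$ coordinates. Put $$p^{(j)}=\tfrac12\bigl(1-(1-2p)^{2^j}\bigr)\ (j\ge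 0),\quad \overline p=p^{(r-2)},\quad \eta(\alpha)=\tfrac12\bigl(1-4\alpha(1-\alpha)\bigr),\quad n_{k,m}=\prod_{i=0}^{k-1}\frac{2^m-2^i}{2^k-2^i}.$$ Then for every $\epsilon$ with $0<\epsilon<\eta(\overline p)$, $$P_{\mathrm{err}}(\mathrm{RM}(m,r))\le 64N^3\, n_{k,m}^{\frac{r-1}{k}}\exp\left(-\ln\left(\frac{1-p^{(r-k-1)}}{p^{(r-k-1)}}\right)2^{-r-1-k}N\epsilon^2\right).$$ -/

import Mathlib

namespace RPA

/-- A binary vector of length `2 ^ m`, its coordinates being indexed by the points of `{0,1}^m`.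
It may be a codeword, a noise vector or a received vector. -/
abbrev Word (m : ℕ) : Type := (Fin m → ZMod 2) → ZMod 2

/-- The Reed-Muller code `RM(m, r)`: all evaluation vectors of polynomials in `m` variables over
the field with two elements and of degree at most `r`. -/
def RM (m r : ℕ) : Set (Word m) :=
  {c | ∃ f : MvPolynomial (Fin m) (ZMod 2), f.totalDegree ≤ r ∧ ∀ z, c z = MvPolynomial.eval z f}

/-- The `k`-dimensional subspaces of `{0,1}^m`. -/
abbrev KSubspace (k m : ℕ) : Type :=
  {B : Submodule (ZMod 2) (Fin m → ZMod 2) // Module.finrank (ZMod 2) B = k}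

noncomputable instance (k m : ℕ) : Fintype (KSubspace k m) := Fintype.ofFinite _

/-- A way of indexing, for every `m` and every `k`-dimensional subspace `B` of `{0,1}^m`, the
cosets of `B` by the vectors of `{0,1}^(m-k)`, compatible with the linear structure. -/
abbrev CosetIndexing (k : ℕ) : Type :=
  ∀ (m : ℕ) (B : KSubspace k m),
    ((Fin m → ZMod 2) ⧸ B.1) ≃ₗ[ZMod 2] (Fin (m - k) → ZMod 2)

/-- The index of the coset `x + B`. -/
def cosetIndex {k : ℕ} (e : CosetIndexing k) {m : ℕ} (B : KSubspace k m)
    (x : Fin m → ZMod 2) : Fin (m - k) → ZMod 2 :=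
  e m B (Submodule.Quotient.mk x)

/-- The projection of `Y` onto the cosets of `B`: its coordinate at a coset is the sum modulo `2`
of the coordinates of `Y` that lie in this coset. -/
def project {k : ℕ} (e : CosetIndexing k) {m : ℕ} (B : KSubspace k m) (Y : Word m) :
    Word (m - k) :=
  fun T => ∑ x with cosetIndex e B x = T, Y x

/-- `disagreements e Y Yhat x` is the number of `k`-dimensional subspaces `B` for which the
projection of `Y` and its decoded version `Yhat B` differ at the coset `x + B`. -/
noncomputable def disagreements {k : ℕ} (e : CosetIndexing k) {m : ℕ} (Y : Word m)
    (Yhat : KSubspace k m → Word (m - k)) (x : Fin m → ZMod 2) : ℕ :=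
  ∑ B : KSubspace k m,
    if project e B Y (cosetIndex e B x) ≠ Yhat B (cosetIndex e B x) then 1 else 0

/-- The aggregation step: the coordinate at `x` is flipped exactly when more than half of all
`k`-dimensional subspaces vote for a flip. -/
noncomputable def aggregate {k : ℕ} (e : CosetIndexing k) {m : ℕ} (Y : Word m)
    (Yhat : KSubspace k m → Word (m - k)) : Word m :=
  fun x => Y x +
    if (Fintype.card (KSubspace k m) : ℚ) / 2 < (disagreements e Y Yhat x : ℚ) then 1 else 0

/-- Run at most `M` iterations of `step`, stopping as soon as an iteration changes nothing. -/
def iterateUntilStable {m : ℕ} (step : Word m → Word m) : ℕ → Word m → Word m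
  | 0, Y => Y
  | M + 1, Y => if Y = step Y then Y else iterateUntilStable step M (step Y)

/-- `D` is a maximum likelihood decoder (over a binary symmetric channel with crossover probability
less than `1/2`) for first-order Reed-Muller codes: it returns a codeword at minimum Hamming
distance from the received vector. Ties may be broken in any way. -/
def IsFirstOrderML (D : ∀ m : ℕ, Word m → Word m) : Prop :=
  ∀ (m : ℕ) (Y : Word m),
    D m Y ∈ RM m 1 ∧ ∀ c ∈ RM m 1, hammingDist Y (D m Y) ≤ hammingDist Y c

/-- The recursive projection-aggregation decoder with `k`-dimensional subspaces, at most `M`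
iterations per call and first-order decoder `D`, for the Reed-Muller code of order `d * k + 1`
and length `2 ^ m`. For `d = 0` the code has order one and `D` is used. Otherwise every iteration
decodes all the projections, which are noisy codewords of order `(d - 1) * k + 1` and length
`2 ^ (m - k)`, and then aggregates the results. -/
noncomputable def rpaAux {k : ℕ} (e : CosetIndexing k) (D : ∀ m : ℕ, Word m → Word m) (M : ℕ) :
    (d m : ℕ) → Word m → Word m
  | 0, m => D m
  | d + 1, m => iterateUntilStable
      (fun Y => aggregate e Y (fun B => rpaAux e D M d (m - k) (project e B Y))) M

/-- The recursive projection-aggregation decoder for `RM(m, r)`, where `k` divides `r - 1`. -/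
noncomputable def rpa {k : ℕ} (e : CosetIndexing k) (D : ∀ m : ℕ, Word m → Word m) (M : ℕ)
    (m r : ℕ) : Word m → Word m :=
  rpaAux e D M ((r - 1) / k) m

/-- The probability of the noise vector `ν` under the product of Bernoulli(`p`) distributions. -/
def noiseProb (p : ℝ) {m : ℕ} (ν : Word m) : ℝ :=
  ∏ z, if ν z = 1 then p else 1 - p

/-- The probability that the decoder `dec` does not return `c` when `c` is sent over the binary
symmetric channel with crossover probability `p`. -/
def errProbOf (p : ℝ) {m : ℕ} (dec : Word m → Word m) (c : Word m) : ℝ :=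
  ∑ ν : Word m with dec (c + ν) ≠ c, noiseProb p ν

open Classical in
/-- The probability of error of the decoder `dec` over the binary symmetric channel with crossover
probability `p` when the codeword is chosen uniformly at random from `RM(m, r)`. -/
noncomputable def errProb (p : ℝ) (m r : ℕ) (dec : Word m → Word m) : ℝ :=
  (∑ c : Word m with c ∈ RM m r, errProbOf p dec c) / ((RM m r).ncard : ℝ)

/-- The Gaussian binomial coefficient `n_{k,m}` (for the field with two elements). -/
noncomputable def gaussBinom (m k : ℕ) : ℝ :=
  ∏ i ∈ Finset.range k, ((2 : ℝ) ^ m - 2 ^ i) / (2 ^ k - 2 ^ i)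

/-- `p^{(j)}`, the probability that a sum modulo `2` of `2 ^ j` independent Bernoulli(`p`) variables
is `1`. -/
noncomputable def pIter (p : ℝ) (j : ℕ) : ℝ := (1 - (1 - 2 * p) ^ (2 ^ j)) / 2

/-- The threshold function `η`. -/
noncomputable def eta (a : ℝ) : ℝ := (1 - 4 * a * (1 - a)) / 2

end RPA

/-! Fix a transmitted codeword `c` and write `r = d * k + 1`. The error bound is a union bound over
a recursion tree of depth `d`. Projecting along a `k`-dimensional subspace amounts to `k` discrete
derivatives, so it lowers the order of `c` by `k` (`project_mem_rm`). The noise on the cosets is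
again i.i.d. Bernoulli, with parameter `pIter p k` (`sum_prodProb_parity_blocks`). If all
projections are decoded correctly, the vote of `B` at `x` is wrong exactly when the noise has odd
parity on `x + B` without `x`. If wrong votes are a strict minority at every `x`, one iteration
produces `c`, and `c` is a fixed point of all later ones (`errProbOf_rpaAux_succ_le`).

The expected proportion of wrong votes is at most `1/2 - ε`, because `η(p^(r-2)) = 1/2 - p^(r-1)`.
One noise bit influences a proportion of at most `2^k / 2^m` of the votes, because the linear group
is transitive on nonzero vectors. A bounded-differences inequality then gives concentration
(`sum_prodProb_wrongVotes_le`); the factor `log ((1 - p) / p)` comes from a moment generating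
function bound that exploits the bias of the bits (`bernoulli_mgf_le`).

At the leaves, a Bhattacharyya union bound over the nonzero first-order codewords suffices, since
these have weight at least half the length; `bhattacharyya_pow_le` brings it to the same
exponential. Down the tree the length shrinks and the noise grows, so the last aggregation, at
crossover probability `p^(r-k-1)`, dictates the exponent. Each level costs one factor `n_{k,m}`, and
`64 N^3` absorbs the remaining multiplicities. -/

namespace RPA

/-! ### Product Bernoulli measures and parities -/

/-- The probability of the bit `b` under the Bernoulli(`p`) distribution. -/
def bitProb (p : ℝ) (b : ZMod 2) : ℝ := if b = 1 then p else 1 - p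

lemma eq_zero_or_one (b : ZMod 2) : b = 0 ∨ b = 1 := by
  revert b; decide

lemma sum_zmod_two {M : Type*} [AddCommMonoid M] (f : ZMod 2 → M) : ∑ b, f b = f 0 + f 1 :=
  Fin.sum_univ_two f

lemma bitProb_zero (p : ℝ) : bitProb p 0 = 1 - p := by simp [bitProb]

lemma bitProb_one (p : ℝ) : bitProb p 1 = p := by simp [bitProb]

lemma bitProb_nonneg {p : ℝ} (h0 : 0 ≤ p) (h1 : p ≤ 1) (b : ZMod 2) : 0 ≤ bitProb p b := by
  unfold bitProb; split_ifs <;> linarith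

/-- The product of Bernoulli(`p`) distributions on binary vectors indexed by `ι`. -/
def prodProb {ι : Type*} [Fintype ι] (p : ℝ) (ν : ι → ZMod 2) : ℝ := ∏ i, bitProb p (ν i)

lemma prodProb_nonneg {ι : Type*} [Fintype ι] {p : ℝ} (h0 : 0 ≤ p) (h1 : p ≤ 1)
    (ν : ι → ZMod 2) : 0 ≤ prodProb p ν :=
  Finset.prod_nonneg fun _ _ => bitProb_nonneg h0 h1 _

/-- The expectation of a product of functions of the single coordinates. -/
lemma sum_prodProb_mul_prod {ι : Type*} [Fintype ι] [DecidableEq ι] (p : ℝ)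
    (g : ι → ZMod 2 → ℝ) :
    ∑ ν : ι → ZMod 2, prodProb p ν * ∏ i, g i (ν i) = ∏ i, ((1 - p) * g i 0 + p * g i 1) := by
  have h := Fintype.prod_sum (fun i b => bitProb p b * g i b)
  simp only [sum_zmod_two, bitProb_zero, bitProb_one] at h
  rw [h]
  exact Finset.sum_congr rfl fun ν _ => by rw [prodProb, Finset.prod_mul_distrib]

lemma sum_prodProb {ι : Type*} [Fintype ι] [DecidableEq ι] (p : ℝ) :
    ∑ ν : ι → ZMod 2, prodProb p ν = 1 := by
  simpa using sum_prodProb_mul_prod (ι := ι) p (fun _ _ => 1)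

/-- Markov's inequality in the form of a Chernoff bound. -/
lemma sum_prodProb_filter_le {ι : Type*} [Fintype ι] [DecidableEq ι] {p : ℝ} (h0 : 0 ≤ p)
    (h1 : p ≤ 1) (P : (ι → ZMod 2) → Prop) [DecidablePred P] (f : (ι → ZMod 2) → ℝ)
    (hf0 : ∀ ν, 0 ≤ f ν) (hf : ∀ ν, P ν → 1 ≤ f ν) :
    ∑ ν with P ν, prodProb p ν ≤ ∑ ν, prodProb p ν * f ν := by
  rw [Finset.sum_filter]
  refine Finset.sum_le_sum fun ν _ => ?_
  have hw := prodProb_nonneg h0 h1 ν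
  split_ifs with h
  · exact le_mul_of_one_le_right hw (hf ν h)
  · exact mul_nonneg hw (hf0 ν)

/-- The nontrivial additive character of the field with two elements. -/
def sgn (b : ZMod 2) : ℝ := if b = 1 then -1 else 1

lemma sgn_zero : sgn 0 = 1 := by simp [sgn]

lemma sgn_one : sgn 1 = -1 := by simp [sgn]

lemma sgn_add (a b : ZMod 2) : sgn (a + b) = sgn a * sgn b := by
  have h : (1 + 1 : ZMod 2) = 0 := by decide
  rcases eq_zero_or_one a with rfl | rfl <;> rcases eq_zero_or_one b with rfl | rfl <;>
    simp [sgn, h]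

lemma sgn_sum {ι : Type*} (s : Finset ι) (f : ι → ZMod 2) :
    sgn (∑ i ∈ s, f i) = ∏ i ∈ s, sgn (f i) := by
  classical
  induction s using Finset.induction_on with
  | empty => simp [sgn_zero]
  | insert a s ha ih => rw [Finset.sum_insert ha, Finset.prod_insert ha, sgn_add, ih]

lemma sum_prodProb_mul_sgn {ι : Type*} [Fintype ι] [DecidableEq ι] (p : ℝ) (s : Finset ι) :
    ∑ ν : ι → ZMod 2, prodProb p ν * sgn (∑ i ∈ s, ν i) = (1 - 2 * p) ^ s.card := by
  have h := sum_prodProb_mul_prod p (fun i b => if i ∈ s then sgn b else 1)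
  simp only [Finset.prod_ite_mem, Finset.univ_inter, ← sgn_sum] at h
  rw [h, ← Finset.prod_const, ← Finset.prod_subset (Finset.subset_univ s)]
  · exact Finset.prod_congr rfl fun i hi => by simp only [hi, if_true, sgn_zero, sgn_one]; ring
  · intro i _ hi
    simp [hi]

/-- The parity of a set of independent Bernoulli variables is a Bernoulli variable. -/
lemma sum_prodProb_parity {ι : Type*} [Fintype ι] [DecidableEq ι] (p : ℝ) (s : Finset ι)
    (b : ZMod 2) :
    ∑ ν : ι → ZMod 2 with ∑ i ∈ s, ν i = b, prodProb p ν =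
      bitProb ((1 - (1 - 2 * p) ^ s.card) / 2) b := by
  -- Fourier expansion of the indicator of `a = b`: it equals `(1 + sgn b * sgn a) / 2`.
  have key : ∀ ν : ι → ZMod 2, (if ∑ i ∈ s, ν i = b then prodProb p ν else 0) =
      (prodProb p ν + sgn b * (prodProb p ν * sgn (∑ i ∈ s, ν i))) / 2 := by
    intro ν
    generalize ∑ i ∈ s, ν i = a
    rcases eq_zero_or_one a with rfl | rfl <;> rcases eq_zero_or_one b with rfl | rfl <;>
      simp [sgn]
  rw [Finset.sum_filter, Finset.sum_congr rfl fun ν _ => key ν, ← Finset.sum_div,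
    Finset.sum_add_distrib, ← Finset.mul_sum, sum_prodProb, sum_prodProb_mul_sgn]
  rcases eq_zero_or_one b with rfl | rfl <;> simp [sgn, bitProb] <;> ring

/-- The parities of the blocks of a partition are independent Bernoulli variables. -/
lemma sum_prodProb_parity_blocks {ι τ : Type*} [Fintype ι] [DecidableEq ι] [Fintype τ]
    [DecidableEq τ] (p : ℝ) (π : ι → τ) (K : ℕ) (hK : ∀ t, (Finset.univ.filter (π · = t)).card = K)
    (F : (τ → ZMod 2) → ℝ) :
    ∑ ν : ι → ZMod 2, prodProb p ν * F (fun t => ∑ i with π i = t, ν i) =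
      ∑ μ : τ → ZMod 2, prodProb ((1 - (1 - 2 * p) ^ K) / 2) μ * F μ := by
  rw [← Finset.sum_fiberwise Finset.univ (fun ν : ι → ZMod 2 => fun t => ∑ i with π i = t, ν i)]
  refine Finset.sum_congr rfl fun μ _ => ?_
  have hF : ∀ ν ∈ Finset.univ.filter
      (fun ν : ι → ZMod 2 => (fun t => ∑ i with π i = t, ν i) = μ),
      prodProb p ν * F (fun t => ∑ i with π i = t, ν i) = prodProb p ν * F μ := by
    intro ν hν
    rw [(Finset.mem_filter.mp hν).2]
  rw [Finset.sum_congr rfl hF, ← Finset.sum_mul]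
  congr 1
  -- Each factor becomes a sum over the noise on one block; expanding the product of these sums
  -- gives a sum over all families of block noises, which `E` identifies with the noise on the whole
  -- of `ι`.
  have hblock : ∀ t, bitProb ((1 - (1 - 2 * p) ^ K) / 2) (μ t) =
      ∑ ν : {i // π i = t} → ZMod 2, if ∑ i, ν i = μ t then prodProb p ν else 0 := by
    intro t
    rw [← Finset.sum_filter, sum_prodProb_parity, Finset.card_univ, Fintype.card_subtype, hK]
  rw [prodProb, Finset.prod_congr rfl fun t _ => hblock t, Fintype.prod_sum, Finset.sum_filter]
  let E : (ι → ZMod 2) ≃ (∀ t, {i // π i = t} → ZMod 2) :=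
    { toFun := fun ν t i => ν i
      invFun := fun h i => h (π i) ⟨i, rfl⟩
      left_inv := fun ν => rfl
      right_inv := fun h => by
        funext t i
        obtain ⟨i, rfl⟩ := i
        rfl }
  refine Fintype.sum_equiv E _ _ fun ν => ?_
  have hs : ∀ t, ∑ i : {i // π i = t}, E ν t i = ∑ i with π i = t, ν i := fun t =>
    (Finset.sum_subtype (Finset.univ.filter (π · = t)) (by simp) ν).symm
  have hp : ∏ t, prodProb p (E ν t) = prodProb p ν := by
    rw [prodProb, ← Finset.prod_fiberwise Finset.univ π]
    refine Finset.prod_congr rfl fun t _ => ?_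
    exact (Finset.prod_subtype (Finset.univ.filter (π · = t)) (by simp)
      (fun i => bitProb p (ν i))).symm
  simp only [hs]
  by_cases h : (fun t => ∑ i with π i = t, ν i) = μ
  · rw [if_pos h, ← hp]
    exact Finset.prod_congr rfl fun t _ => by rw [if_pos (congrFun h t)]
  · rw [if_neg h]
    obtain ⟨t, ht⟩ := Function.ne_iff.mp h
    exact (Finset.prod_eq_zero (Finset.mem_univ t) (if_neg ht)).symm

/-! ### Bounded differences for biased bits -/

/-- A bound for the moment generating function of a centred Bernoulli variable. -/
lemma bernoulli_mgf_le {p L s : ℝ} (hp0 : 0 < p) (hp1 : p < 1 / 2) (hL0 : 0 < L)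
    (hL : L ≤ Real.log ((1 - p) / p)) (hs : |s| ≤ L / 8) :
    (1 - p) + p * Real.exp s ≤ Real.exp (s ^ 2 / L + p * s) := by
  have hpL : p ≤ Real.exp (-L) := by
    have h1 : Real.exp L ≤ (1 - p) / p := by
      rw [← Real.exp_log (show 0 < (1 - p) / p by apply div_pos <;> linarith)]
      exact Real.exp_le_exp.mpr hL
    rw [Real.exp_neg, le_inv_comm₀ hp0 (Real.exp_pos _)]
    refine h1.trans ?_
    rw [inv_eq_one_div]
    gcongr
    linarith
  have hexp : Real.exp s - 1 - s ≤ s ^ 2 * Real.exp |s| := by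
    have h := Complex.norm_exp_sub_sum_le_norm_mul_exp (s : ℂ) 2
    simp only [Finset.sum_range_succ, Finset.sum_range_zero, Complex.norm_real, Real.norm_eq_abs,
      sq_abs] at h
    have h2 : Complex.exp s - (0 + (s : ℂ) ^ 0 / (Nat.factorial 0 : ℕ) +
        (s : ℂ) ^ 1 / (Nat.factorial 1 : ℕ)) = ((Real.exp s - 1 - s : ℝ) : ℂ) := by
      push_cast [Nat.factorial]; ring
    rw [h2, Complex.norm_real, Real.norm_eq_abs] at h
    exact (le_abs_self _).trans h
  -- As `p ≤ exp (-L)` and `|s| ≤ L / 8`, the left side is at most `exp (-7L/8)`, and `exp t ≥ 1 + t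
  -- + t^2/2` at `t = 7L/8` exceeds `L`. This is where the bias turns the quadratic term into `s^2 /
  -- L`.
  have hsmall : p * Real.exp |s| ≤ 1 / L := by
    have h1 : p * Real.exp |s| ≤ Real.exp (-(7 * L / 8)) := by
      calc p * Real.exp |s| ≤ Real.exp (-L) * Real.exp (L / 8) := by gcongr
        _ = Real.exp (-(7 * L / 8)) := by rw [← Real.exp_add]; congr 1; ring
    refine h1.trans ?_
    rw [Real.exp_neg, inv_eq_one_div]
    apply one_div_le_one_div_of_le hL0
    have := Real.quadratic_le_exp_of_nonneg (show 0 ≤ 7 * L / 8 by positivity)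
    nlinarith [sq_nonneg (L - 1)]
  calc (1 - p) + p * Real.exp s = (p * (Real.exp s - 1 - s) + p * s) + 1 := by ring
    _ ≤ (p * (s ^ 2 * Real.exp |s|) + p * s) + 1 := by gcongr
    _ = (s ^ 2 * (p * Real.exp |s|) + p * s) + 1 := by ring
    _ ≤ (s ^ 2 * (1 / L) + p * s) + 1 := by gcongr
    _ = (s ^ 2 / L + p * s) + 1 := by ring
    _ ≤ _ := Real.add_one_le_exp _

lemma sum_prodProb_option {α : Type*} [Fintype α] [DecidableEq α] (p : ℝ)
    (F : (Option α → ZMod 2) → ℝ) :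
    ∑ ν : Option α → ZMod 2, prodProb p ν * F ν =
      ∑ μ : α → ZMod 2, prodProb p μ * ((1 - p) * F (fun o => o.elim 0 μ) +
        p * F (fun o => o.elim 1 μ)) := by
  let E : (Option α → ZMod 2) ≃ ZMod 2 × (α → ZMod 2) :=
    { toFun := fun ν => (ν none, fun a => ν (some a))
      invFun := fun x o => o.elim x.1 x.2
      left_inv := fun ν => by funext o; cases o <;> rfl
      right_inv := fun x => rfl }
  rw [← E.symm.sum_comp, Fintype.sum_prod_type_right]
  refine Finset.sum_congr rfl fun μ _ => ?_
  have h : ∀ b, prodProb p (E.symm (b, μ)) = bitProb p b * prodProb p μ := fun b => by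
    rw [prodProb, Fintype.prod_option]; rfl
  rw [sum_zmod_two, h, h, bitProb_zero, bitProb_one]
  change (1 - p) * prodProb p μ * F (fun o => o.elim 0 μ) +
    p * prodProb p μ * F (fun o => o.elim 1 μ) = _
  ring

/-- A form of McDiarmid's inequality: the moment generating function of a function with bounded
differences of independent Bernoulli variables. -/
lemma sum_prodProb_exp_le {ι : Type*} [Fintype ι] [DecidableEq ι] {p L c : ℝ} (hp0 : 0 < p)
    (hp1 : p < 1 / 2) (hL0 : 0 < L) (hL : L ≤ Real.log ((1 - p) / p)) (hcL : c ≤ L / 8)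
    (f : (ι → ZMod 2) → ℝ) (hf : ∀ ν i b, |f (Function.update ν i b) - f ν| ≤ c) :
    ∑ ν, prodProb p ν * Real.exp (f ν) ≤
      Real.exp (Fintype.card ι * (c ^ 2 / L) + ∑ ν, prodProb p ν * f ν) := by
  revert f
  -- One coordinate is integrated out at a time, at the cost of a factor `exp (c^2 / L)`; the
  -- partial average still has differences bounded by `c`, so no martingale is needed.
  refine Fintype.induction_empty_option (P := fun ι [Fintype ι] => ∀ [DecidableEq ι]
    (f : (ι → ZMod 2) → ℝ), (∀ ν i b, |f (Function.update ν i b) - f ν| ≤ c) →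
    ∑ ν, prodProb p ν * Real.exp (f ν) ≤
      Real.exp (Fintype.card ι * (c ^ 2 / L) + ∑ ν, prodProb p ν * f ν)) ?_ ?_ ?_ ι
  · intro α β _ e ih _ f hf
    let _ := Fintype.ofEquiv β e.symm
    let _ := e.decidableEq
    have hsum : ∀ g : (β → ZMod 2) → ℝ, ∑ ν, prodProb p ν * g ν =
        ∑ ν : α → ZMod 2, prodProb p ν * g (ν ∘ e.symm) := fun g => by
      refine Fintype.sum_equiv (e.symm.arrowCongr (Equiv.refl _)) _ _ fun ν => ?_
      have h1 : prodProb p ((e.symm.arrowCongr (Equiv.refl (ZMod 2))) ν) = prodProb p ν :=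
        e.prod_comp fun i => bitProb p (ν i)
      rw [h1]
      congr 2
      funext i
      simp
    rw [hsum, hsum, ← Fintype.card_congr e]
    refine ih (fun ν => f (ν ∘ e.symm)) fun ν i b => ?_
    have h2 : Function.update ν i b ∘ e.symm = Function.update (ν ∘ e.symm) (e i) b := by
      funext j
      by_cases hj : j = e i
      · subst hj; simp
      · have : e.symm j ≠ i := fun h => hj (by rw [← h]; simp)
        simp [hj, this]
    rw [h2]
    exact hf _ _ _
  · intro _ f _
    simp [prodProb]
  · intro α _ ih hdec f hf
    classical
    obtain rfl : hdec = Option.instDecidableEq := Subsingleton.elim _ _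
    have hmgf : ∀ μ : α → ZMod 2,
        (1 - p) * Real.exp (f fun o => o.elim 0 μ) + p * Real.exp (f fun o => o.elim 1 μ) ≤
        Real.exp (c ^ 2 / L) * Real.exp ((1 - p) * (f fun o => o.elim 0 μ) +
          p * (f fun o => o.elim 1 μ)) := by
      intro μ
      set a := f fun o => o.elim 0 μ
      set b := f fun o => o.elim 1 μ
      have hab : |b - a| ≤ c := by
        have h := hf (fun o => o.elim 0 μ) none 1
        have hu : Function.update (fun o : Option α => o.elim 0 μ) none 1 =
            fun o => o.elim 1 μ := by
          funext o; cases o <;> simp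
        rwa [hu] at h
      have hm := bernoulli_mgf_le hp0 hp1 hL0 hL (hab.trans hcL)
      have hsq : (b - a) ^ 2 ≤ c ^ 2 := sq_le_sq' (abs_le.mp hab).1 (abs_le.mp hab).2
      calc (1 - p) * Real.exp a + p * Real.exp b
          = Real.exp a * ((1 - p) + p * Real.exp (b - a)) := by
            rw [Real.exp_sub]; field_simp
        _ ≤ Real.exp a * Real.exp ((b - a) ^ 2 / L + p * (b - a)) := by gcongr
        _ ≤ Real.exp a * Real.exp (c ^ 2 / L + p * (b - a)) := by gcongr
        _ = _ := by rw [← Real.exp_add, ← Real.exp_add]; congr 1; ring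
    have hdiff : ∀ (b' : ZMod 2) (μ : α → ZMod 2) i b,
        |(f fun o => o.elim b' (Function.update μ i b)) - f fun o => o.elim b' μ| ≤ c := by
      intro b' μ i b
      have h := hf (fun o => o.elim b' μ) (some i) b
      have hu : Function.update (fun o : Option α => o.elim b' μ) (some i) b =
          fun o => o.elim b' (Function.update μ i b) := by
        funext o
        cases o with
        | none => simp
        | some j => by_cases hj : j = i <;> simp [hj]
      rwa [hu] at h
    have hcard : (Fintype.card (Option α) : ℝ) = Fintype.card α + 1 := by simp
    rw [sum_prodProb_option, sum_prodProb_option, hcard]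
    calc _ ≤ ∑ μ : α → ZMod 2, prodProb p μ * (Real.exp (c ^ 2 / L) *
          Real.exp ((1 - p) * (f fun o => o.elim 0 μ) + p * (f fun o => o.elim 1 μ))) := by
          refine Finset.sum_le_sum fun μ _ => mul_le_mul_of_nonneg_left (hmgf μ) ?_
          exact prodProb_nonneg hp0.le (by linarith) μ
      _ = Real.exp (c ^ 2 / L) * ∑ μ : α → ZMod 2, prodProb p μ *
          Real.exp ((1 - p) * (f fun o => o.elim 0 μ) + p * (f fun o => o.elim 1 μ)) := by
          rw [Finset.mul_sum]
          exact Finset.sum_congr rfl fun μ _ => by ring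
      _ ≤ Real.exp (c ^ 2 / L) * Real.exp (Fintype.card α * (c ^ 2 / L) +
          ∑ μ : α → ZMod 2, prodProb p μ *
            ((1 - p) * (f fun o => o.elim 0 μ) + p * (f fun o => o.elim 1 μ))) := by
          gcongr
          refine ih _ fun μ i b => ?_
          have h0 := abs_le.mp (hdiff 0 μ i b)
          have h1 := abs_le.mp (hdiff 1 μ i b)
          rw [abs_le]
          constructor <;> nlinarith
      _ = _ := by rw [← Real.exp_add]; congr 1; ring

/-! ### Counting subspaces -/

lemma card_linearIndependent_fiber {k m : ℕ} (B : KSubspace k m) :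
    Nat.card {s : Fin k → Fin m → ZMod 2 //
      LinearIndependent (ZMod 2) s ∧ Submodule.span (ZMod 2) (Set.range s) = B.1} =
      ∏ i : Fin k, (2 ^ k - 2 ^ i.val) := by
  have h := card_linearIndependent (K := ZMod 2) (V := B.1) (k := k) B.2.ge
  rw [B.2, ZMod.card] at h
  rw [← h]
  refine Nat.card_congr
    { toFun := fun s => ⟨fun i => ⟨s.1 i, s.2.2.le (Submodule.subset_span ⟨i, rfl⟩)⟩,
        LinearIndependent.of_comp B.1.subtype s.2.1⟩
      invFun := fun t => ⟨fun i => t.1 i, t.2.map' B.1.subtype B.1.ker_subtype, ?_⟩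
      left_inv := fun s => rfl
      right_inv := fun t => rfl }
  refine Submodule.eq_of_le_of_finrank_eq (Submodule.span_le.mpr ?_) ?_
  · rintro _ ⟨i, rfl⟩
    exact (t.1 i).2
  · rw [B.2]
    exact (finrank_span_eq_card (t.2.map' B.1.subtype B.1.ker_subtype)).trans (Fintype.card_fin k)

/-- Linearly independent `k`-tuples in the whole space are fibred over their spans, every fibre
being the set of ordered bases of a `k`-dimensional space. -/
lemma card_kSubspace_mul {k m : ℕ} (hkm : k ≤ m) :
    Fintype.card (KSubspace k m) * ∏ i : Fin k, (2 ^ k - 2 ^ i.val) =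
      ∏ i : Fin k, (2 ^ m - 2 ^ i.val) := by
  have h := card_linearIndependent (K := ZMod 2) (V := Fin m → ZMod 2) (k := k) (by simpa)
  rw [Module.finrank_fin_fun, ZMod.card] at h
  rw [← h]
  let S : {s : Fin k → Fin m → ZMod 2 // LinearIndependent (ZMod 2) s} → KSubspace k m :=
    fun s => ⟨Submodule.span (ZMod 2) (Set.range s.1),
      (finrank_span_eq_card s.2).trans (Fintype.card_fin k)⟩
  have hfib : ∀ B, Nat.card {s // S s = B} = ∏ i : Fin k, (2 ^ k - 2 ^ i.val) := fun B => by
    rw [← card_linearIndependent_fiber B]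
    exact Nat.card_congr
      { toFun := fun s => ⟨s.1.1, s.1.2, congrArg Subtype.val s.2⟩
        invFun := fun s => ⟨⟨s.1, s.2.1⟩, Subtype.ext s.2.2⟩
        left_inv := fun s => rfl
        right_inv := fun s => rfl }
  rw [← Nat.card_congr (Equiv.sigmaFiberEquiv S), Nat.card_sigma, Finset.sum_congr rfl
    fun B _ => hfib B, Finset.sum_const, Finset.card_univ, smul_eq_mul]

lemma card_kSubspace {k m : ℕ} (hkm : k ≤ m) :
    (Fintype.card (KSubspace k m) : ℝ) = gaussBinom m k := by
  have hcast : ∀ n, k ≤ n → ((∏ i : Fin k, (2 ^ n - 2 ^ i.val) : ℕ) : ℝ) =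
      ∏ i ∈ Finset.range k, ((2 : ℝ) ^ n - 2 ^ i) := fun n hn => by
    rw [Finset.prod_range, Nat.cast_prod]
    refine Finset.prod_congr rfl fun i _ => ?_
    rw [Nat.cast_sub (Nat.pow_le_pow_right (by norm_num) (i.2.le.trans hn))]
    push_cast
    rfl
  have h := congrArg (Nat.cast : ℕ → ℝ) (card_kSubspace_mul hkm)
  rw [Nat.cast_mul, hcast k le_rfl, hcast m hkm] at h
  rw [gaussBinom, Finset.prod_div_distrib, eq_div_iff, h]
  refine Finset.prod_ne_zero_iff.mpr fun i hi => (sub_pos.mpr ?_).ne'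
  exact pow_lt_pow_right₀ (by norm_num) (Finset.mem_range.mp hi)

lemma gaussBinom_mono {k m n : ℕ} (hkm : k ≤ m) (hmn : m ≤ n) :
    gaussBinom m k ≤ gaussBinom n k := by
  have hlt : ∀ i ∈ Finset.range k, ∀ j, k ≤ j → (0 : ℝ) < 2 ^ j - 2 ^ i := fun i hi j hj =>
    sub_pos.mpr (pow_lt_pow_right₀ (by norm_num) ((Finset.mem_range.mp hi).trans_le hj))
  refine Finset.prod_le_prod (fun i hi => ?_) fun i hi => ?_
  · exact (div_pos (hlt i hi m hkm) (hlt i hi k le_rfl)).le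
  · have := hlt i hi k le_rfl
    have h2 : (2 : ℝ) ^ m ≤ 2 ^ n := pow_le_pow_right₀ (by norm_num) hmn
    gcongr

lemma one_le_gaussBinom {k m : ℕ} (hkm : k ≤ m) : 1 ≤ gaussBinom m k := by
  refine le_trans (le_of_eq ?_) (gaussBinom_mono le_rfl hkm)
  refine (Finset.prod_eq_one fun i hi => div_self (sub_pos.mpr ?_).ne').symm
  exact pow_lt_pow_right₀ (by norm_num) (Finset.mem_range.mp hi)

lemma exists_linearEquiv_apply_eq {m : ℕ} {v w : Fin m → ZMod 2} (hv : v ≠ 0) (hw : w ≠ 0) :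
    ∃ g : (Fin m → ZMod 2) ≃ₗ[ZMod 2] (Fin m → ZMod 2), g v = w := by
  obtain ⟨g, hg⟩ := Submodule.exists_linearEquiv_restrict_eq
    ((LinearEquiv.toSpanNonzeroSingleton (ZMod 2) _ v hv).symm ≪≫ₗ
      LinearEquiv.toSpanNonzeroSingleton (ZMod 2) _ w hw)
  refine ⟨g, ?_⟩
  have h := hg ⟨v, Submodule.mem_span_singleton_self v⟩
  rw [← h]
  have h1 : (LinearEquiv.toSpanNonzeroSingleton (ZMod 2) _ v hv).symm
      ⟨v, Submodule.mem_span_singleton_self v⟩ = 1 := by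
    rw [LinearEquiv.symm_apply_eq]
    ext
    simp
  simp [h1]

-- An invertible linear map carrying `v` to `w` permutes the `k`-dimensional subspaces.
open Classical in
lemma card_kSubspace_mem_congr {k m : ℕ} {v w : Fin m → ZMod 2} (hv : v ≠ 0) (hw : w ≠ 0) :
    (Finset.univ.filter fun B : KSubspace k m => v ∈ B.1).card =
      (Finset.univ.filter fun B : KSubspace k m => w ∈ B.1).card := by
  obtain ⟨g, rfl⟩ := exists_linearEquiv_apply_eq hv hw
  refine Finset.card_bij (fun B _ => ⟨B.1.map (g : _ →ₗ[ZMod 2] _), ?_⟩) ?_ ?_ ?_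
  · rw [LinearEquiv.finrank_map_eq, B.2]
  · intro B hB
    simpa using hB
  · intro B _ B' _ h
    exact Subtype.ext (Submodule.map_injective_of_injective g.injective (congrArg Subtype.val h))
  · intro B hB
    refine ⟨⟨B.1.map (g.symm : _ →ₗ[ZMod 2] _), ?_⟩, ?_, ?_⟩
    · rw [LinearEquiv.finrank_map_eq, B.2]
    · simpa [Submodule.mem_map_equiv] using hB
    · ext x
      simp [Submodule.mem_map_equiv]

open Classical in
/-- The proportion of `k`-dimensional subspaces through a given nonzero point. -/
lemma card_kSubspace_mem_mul_le {k m : ℕ} {v : Fin m → ZMod 2} (hv : v ≠ 0) :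
    ((Finset.univ.filter fun B : KSubspace k m => v ∈ B.1).card : ℝ) * 2 ^ m ≤
      2 ^ k * Fintype.card (KSubspace k m) := by
  set a := (Finset.univ.filter fun B : KSubspace k m => v ∈ B.1).card
  -- Double counting of the pairs of a nonzero vector and a subspace containing it: `h1` counts by
  -- vectors, `h2` by subspaces.
  have h1 : ∑ w : Fin m → ZMod 2 with w ≠ 0,
      (Finset.univ.filter fun B : KSubspace k m => w ∈ B.1).card = (2 ^ m - 1) * a := by
    rw [Finset.sum_congr rfl fun w hw =>
      card_kSubspace_mem_congr (Finset.mem_filter.mp hw).2 hv, Finset.sum_const, smul_eq_mul]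
    congr 1
    rw [Finset.filter_ne' Finset.univ, Finset.card_erase_of_mem (Finset.mem_univ _)]
    simp
  have h2 : ∑ w : Fin m → ZMod 2 with w ≠ 0,
      (Finset.univ.filter fun B : KSubspace k m => w ∈ B.1).card =
      Fintype.card (KSubspace k m) * (2 ^ k - 1) := by
    simp only [Finset.card_filter _ (Finset.univ : Finset (KSubspace k m))]
    rw [Finset.sum_comm, Finset.sum_congr rfl (g := fun _ => 2 ^ k - 1), Finset.sum_const,
      Finset.card_univ, smul_eq_mul]
    intro B _
    rw [← Finset.card_filter, Finset.filter_filter]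
    have hB : (Finset.univ.filter fun w => w ∈ B.1).card = 2 ^ k := by
      rw [← Fintype.card_subtype, Module.card_eq_pow_finrank (K := ZMod 2) (V := B.1), B.2,
        ZMod.card]
    rw [← hB, ← Finset.card_erase_of_mem (a := (0 : Fin m → ZMod 2)) (by simp)]
    congr 1
    ext w
    simp
  have h3 := h1.symm.trans h2
  have ha : a ≤ Fintype.card (KSubspace k m) := Finset.card_le_univ _
  have h4 : (2 ^ m - 1 : ℝ) * a = Fintype.card (KSubspace k m) * (2 ^ k - 1) := by
    have := congrArg (Nat.cast : ℕ → ℝ) h3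
    rw [Nat.cast_mul, Nat.cast_mul, Nat.cast_sub Nat.one_le_two_pow,
      Nat.cast_sub Nat.one_le_two_pow] at this
    simpa using this
  have ha' : (a : ℝ) ≤ Fintype.card (KSubspace k m) := by exact_mod_cast ha
  -- From `(2^m - 1) a = G (2^k - 1)` and `a ≤ G`, with `G` the number of subspaces, `2^m a = G (2^k
  -- - 1) + a ≤ 2^k G`.
  linarith

/-! ### Cosets and projections -/

section Cosets

variable {k : ℕ} (e : CosetIndexing k) {m : ℕ} (B : KSubspace k m)

lemma cosetIndex_eq_iff (x y : Fin m → ZMod 2) :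
    cosetIndex e B x = cosetIndex e B y ↔ x - y ∈ B.1 := by
  rw [cosetIndex, cosetIndex, EmbeddingLike.apply_eq_iff_eq, Submodule.Quotient.eq]

/-- A linear choice of coset representatives: with it a projected word becomes a sum of translates
of `Y` composed with a linear map, so degrees can be controlled. -/
lemma exists_linearMap_cosetIndex :
    ∃ σ : (Fin (m - k) → ZMod 2) →ₗ[ZMod 2] (Fin m → ZMod 2), ∀ T, cosetIndex e B (σ T) = T := by
  obtain ⟨σ, hσ⟩ := ((e m B).toLinearMap ∘ₗ B.1.mkQ).exists_rightInverse_of_surjective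
    (LinearMap.range_eq_top.mpr ((e m B).surjective.comp B.1.mkQ_surjective))
  exact ⟨σ, fun T => LinearMap.congr_fun hσ T⟩

lemma sum_coset [Fintype B.1] {M : Type*} [AddCommMonoid M] (y : Fin m → ZMod 2)
    (f : (Fin m → ZMod 2) → M) :
    ∑ x with cosetIndex e B x = cosetIndex e B y, f x = ∑ b : B.1, f (y + b) := by
  refine (Finset.sum_bij (fun (b : B.1) _ => y + (b : Fin m → ZMod 2)) ?_ ?_ ?_ ?_).symm
  · intro b _
    simp [cosetIndex_eq_iff]
  · intro b _ b' _ h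
    exact Subtype.ext (add_left_cancel h)
  · intro x hx
    exact ⟨⟨x - y, (cosetIndex_eq_iff e B x y).mp (Finset.mem_filter.mp hx).2⟩,
      Finset.mem_univ _, add_sub_cancel _ _⟩
  · intro b _
    rfl

lemma card_coset (T : Fin (m - k) → ZMod 2) :
    (Finset.univ.filter fun x => cosetIndex e B x = T).card = 2 ^ k := by
  classical
  obtain ⟨σ, hσ⟩ := exists_linearMap_cosetIndex e B
  have h := sum_coset e B (σ T) fun _ => 1
  rw [hσ, Finset.sum_const, Finset.sum_const, smul_eq_mul, smul_eq_mul, mul_one, mul_one,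
    Finset.card_univ, Module.card_eq_pow_finrank (K := ZMod 2) (V := B.1), B.2, ZMod.card] at h
  exact h

lemma project_add (Y Z : Word m) : project e B (Y + Z) = project e B Y + project e B Z := by
  funext T
  simp [project, Finset.sum_add_distrib]

end Cosets

/-! ### Reed-Muller codes and discrete derivatives -/

/-- The Reed-Muller code `RM(m, r)` as a linear code. -/
def rmSubmodule (m r : ℕ) : Submodule (ZMod 2) (Word m) where
  carrier := RM m r
  add_mem' := by
    rintro a b ⟨f, hf, hfe⟩ ⟨g, hg, hge⟩
    exact ⟨f + g, (MvPolynomial.totalDegree_add f g).trans (max_le hf hg), fun z => by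
      simp [hfe, hge]⟩
  zero_mem' := ⟨0, by simp, fun z => by simp⟩
  smul_mem' := by
    rintro t a ⟨f, hf, hfe⟩
    exact ⟨t • f, (MvPolynomial.totalDegree_smul_le t f).trans hf, fun z => by simp [hfe]⟩

lemma mem_rmSubmodule {m r : ℕ} {c : Word m} : c ∈ rmSubmodule m r ↔ c ∈ RM m r := Iff.rfl

lemma rm_mono {m r s : ℕ} (h : r ≤ s) {c : Word m} (hc : c ∈ RM m r) : c ∈ RM m s := by
  obtain ⟨f, hf, hfe⟩ := hc
  exact ⟨f, hf.trans h, hfe⟩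

lemma mul_mem_rm {m r s : ℕ} {a b : Word m} (ha : a ∈ RM m r) (hb : b ∈ RM m s) :
    a * b ∈ RM m (r + s) := by
  obtain ⟨f, hf, hfe⟩ := ha
  obtain ⟨g, hg, hge⟩ := hb
  exact ⟨f * g, (MvPolynomial.totalDegree_mul f g).trans (add_le_add hf hg), fun z => by
    simp [hfe, hge]⟩

lemma const_mem_rm {m : ℕ} (a : ZMod 2) (r : ℕ) : (fun _ => a : Word m) ∈ RM m r :=
  ⟨MvPolynomial.C a, by simp, fun z => by simp⟩

lemma coord_mem_rm {m : ℕ} (i : Fin m) : (fun z => z i : Word m) ∈ RM m 1 :=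
  ⟨MvPolynomial.X i, by simp, fun z => by simp⟩

/-- The evaluation vector of a monomial, given by the multiset of its variables. -/
def monoWord {m : ℕ} (s : Multiset (Fin m)) : Word m := fun z => (s.map z).prod

lemma monoWord_zero {m : ℕ} : monoWord (0 : Multiset (Fin m)) = fun _ => 1 := by
  funext z; simp [monoWord]

lemma monoWord_cons {m : ℕ} (i : Fin m) (s : Multiset (Fin m)) :
    monoWord (i ::ₘ s) = (fun z => z i) * monoWord s := by
  funext z; simp [monoWord]

lemma monoWord_mem_rm {m : ℕ} (s : Multiset (Fin m)) : monoWord s ∈ RM m s.card := by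
  induction s using Multiset.induction_on with
  | empty => rw [monoWord_zero]; exact const_mem_rm 1 _
  | cons i s ih =>
    rw [monoWord_cons, Multiset.card_cons, add_comm]
    exact mul_mem_rm (coord_mem_rm i) ih

/-- The Reed-Muller code is spanned by the evaluation vectors of monomials. -/
lemma rm_subset_of_monoWord_mem {m r : ℕ} {S : Submodule (ZMod 2) (Word m)}
    (hS : ∀ s : Multiset (Fin m), s.card ≤ r → monoWord s ∈ S) {c : Word m} (hc : c ∈ RM m r) :
    c ∈ S := by
  obtain ⟨f, hf, hfe⟩ := hc
  have hcf : c = ∑ d ∈ f.support, f.coeff d • monoWord (Finsupp.toMultiset d) := by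
    funext z
    rw [hfe, MvPolynomial.eval_eq, Finset.sum_apply]
    refine Finset.sum_congr rfl fun d _ => ?_
    rw [Pi.smul_apply, smul_eq_mul, monoWord, Finset.prod_multiset_map_count,
      Finsupp.toFinset_toMultiset]
    simp only [Finsupp.count_toMultiset]
  rw [hcf]
  refine S.sum_mem fun d hd => S.smul_mem _ (hS _ ?_)
  rw [Finsupp.card_toMultiset]
  exact (MvPolynomial.le_totalDegree hd).trans hf

/-- Substituting affine functions for the variables does not increase the degree. -/
lemma comp_mem_rm {m n r : ℕ} (φ : (Fin n → ZMod 2) → Fin m → ZMod 2)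
    (hφ : ∀ i, (fun z => φ z i : Word n) ∈ RM n 1) {c : Word m} (hc : c ∈ RM m r) :
    c ∘ φ ∈ RM n r := by
  refine rm_subset_of_monoWord_mem
    (S := (rmSubmodule n r).comap (LinearMap.funLeft (ZMod 2) (ZMod 2) φ)) (fun s hs => ?_) hc
  have key : ∀ s : Multiset (Fin m), monoWord s ∘ φ ∈ RM n s.card := by
    intro s
    induction s using Multiset.induction_on with
    | empty => rw [monoWord_zero]; exact const_mem_rm 1 _
    | cons i s ih =>
      rw [monoWord_cons, Multiset.card_cons, add_comm]
      exact mul_mem_rm (hφ i) ih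
  exact rm_mono hs (key s)

lemma linearMap_comp_mem_rm {m n r : ℕ} (φ : (Fin n → ZMod 2) →ₗ[ZMod 2] (Fin m → ZMod 2))
    {c : Word m} (hc : c ∈ RM m r) : c ∘ φ ∈ RM n r := by
  refine comp_mem_rm φ (fun i => ?_) hc
  have h : (fun z => φ z i : Word n) =
      ∑ j, φ (fun l => if j = l then 1 else 0) i • (fun z => z j : Word n) := by
    funext z
    rw [LinearMap.pi_apply_eq_sum_univ φ z]
    simp [mul_comm]
  rw [h, ← mem_rmSubmodule]
  exact Submodule.sum_mem _ fun j _ => Submodule.smul_mem _ _ (coord_mem_rm j)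

lemma translate_mem_rm {m r : ℕ} (b : Fin m → ZMod 2) {c : Word m} (hc : c ∈ RM m r) :
    (fun z => c (z + b)) ∈ RM m r := by
  refine comp_mem_rm (fun z => z + b) (fun i => ?_) hc
  exact (rmSubmodule m 1).add_mem (coord_mem_rm i) (const_mem_rm (b i) 1)

/-- The derivative of a word in the direction `b`. -/
def derivative {m : ℕ} (b : Fin m → ZMod 2) : Word m →ₗ[ZMod 2] Word m where
  toFun c := fun z => c z + c (z + b)
  map_add' c d := by funext z; simp only [Pi.add_apply]; ring
  map_smul' t c := by funext z; simp only [Pi.smul_apply, smul_eq_mul, RingHom.id_apply]; ring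

lemma derivative_monoWord_mem_rm {m : ℕ} (b : Fin m → ZMod 2) (s : Multiset (Fin m)) (r : ℕ)
    (hs : s.card ≤ r + 1) : derivative b (monoWord s) ∈ RM m r := by
  have h0 : derivative b (monoWord (0 : Multiset (Fin m))) = 0 := by
    rw [monoWord_zero]
    funext z
    exact (by decide : (1 + 1 : ZMod 2) = 0)
  induction s using Multiset.induction_on generalizing r with
  | empty => rw [h0]; exact (rmSubmodule m r).zero_mem
  | cons i s ih =>
    rw [Multiset.card_cons] at hs
    -- A discrete Leibniz rule: splitting off one variable leaves the derivative of a shorter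
    -- monomial times a coordinate, plus a translate of that shorter monomial.
    have hD : derivative b (monoWord (i ::ₘ s)) = (fun z => z i) * derivative b (monoWord s) +
        b i • (fun z => monoWord s (z + b)) := by
      rw [monoWord_cons]
      funext z
      simp only [derivative, LinearMap.coe_mk, AddHom.coe_mk, Pi.mul_apply, Pi.add_apply,
        Pi.smul_apply, smul_eq_mul]
      ring
    rw [hD]
    refine (rmSubmodule m r).add_mem ?_ ((rmSubmodule m r).smul_mem _ ?_)
    · cases r with
      | zero =>
        have : s = 0 := Multiset.card_eq_zero.mp (by omega)
        rw [this, h0, mul_zero]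
        exact (rmSubmodule m 0).zero_mem
      | succ r =>
        rw [add_comm]
        exact mul_mem_rm (coord_mem_rm i) (ih r (by omega))
    · exact translate_mem_rm b (rm_mono (by omega) (monoWord_mem_rm s))

lemma derivative_mem_rm {m r : ℕ} (b : Fin m → ZMod 2) {c : Word m} (hc : c ∈ RM m (r + 1)) :
    derivative b c ∈ RM m r :=
  rm_subset_of_monoWord_mem (S := (rmSubmodule m r).comap (derivative b))
    (fun s hs => derivative_monoWord_mem_rm b s r hs) hc

/-- Summing over all combinations of the `b i` is differentiating once in each direction `b i`, and
every derivative lowers the degree by one. -/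
lemma sum_combination_mem_rm {m r : ℕ} (k : ℕ) (b : Fin k → Fin m → ZMod 2) {c : Word m}
    (hc : c ∈ RM m (r + k)) :
    (fun z => ∑ a : Fin k → ZMod 2, c (z + ∑ i, a i • b i)) ∈ RM m r := by
  induction k generalizing c with
  | zero => simpa using hc
  | succ k ih =>
    have h := ih (fun i => b i.succ) (derivative_mem_rm (b 0) (r := r + k) hc)
    convert h using 2 with z
    rw [← (Fin.consEquiv fun _ => ZMod 2).sum_comp, Fintype.sum_prod_type_right]
    refine Finset.sum_congr rfl fun a _ => ?_
    rw [sum_zmod_two]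
    simp only [derivative, LinearMap.coe_mk, AddHom.coe_mk, Fin.consEquiv_apply, Fin.sum_univ_succ,
      Fin.cons_zero, Fin.cons_succ, zero_smul, one_smul, zero_add]
    congr 2
    abel

/-- The projections of a codeword are codewords of smaller order. -/
lemma project_mem_rm {k : ℕ} (e : CosetIndexing k) {m r : ℕ} (B : KSubspace k m) {c : Word m}
    (hc : c ∈ RM m (r + k)) : project e B c ∈ RM (m - k) r := by
  classical
  obtain ⟨σ, hσ⟩ := exists_linearMap_cosetIndex e B
  let b := Module.finBasisOfFinrankEq (ZMod 2) B.1 B.2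
  have h := linearMap_comp_mem_rm σ (sum_combination_mem_rm k (fun i => (b i : Fin m → ZMod 2)) hc)
  convert h using 1
  funext T
  rw [project, ← hσ T, sum_coset e B, ← b.equivFun.symm.toEquiv.sum_comp]
  simp [hσ, Module.Basis.equivFun_symm_apply]

/-! ### First-order codewords as affine functions -/

/-- The affine function with linear part `a.2` and constant term `a.1`. -/
def affineWord (m : ℕ) : ZMod 2 × (Fin m → ZMod 2) →ₗ[ZMod 2] Word m where
  toFun a := fun z => a.1 + ∑ i, a.2 i * z i
  map_add' a b := by
    funext z
    simp only [Prod.fst_add, Prod.snd_add, Pi.add_apply, add_mul, Finset.sum_add_distrib]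
    ring
  map_smul' t a := by
    funext z
    simp [mul_add, Finset.mul_sum, mul_assoc]

lemma exists_affineWord_eq {m : ℕ} {c : Word m} (hc : c ∈ RM m 1) : ∃ a, affineWord m a = c := by
  refine rm_subset_of_monoWord_mem (S := LinearMap.range (affineWord m)) (fun s hs => ?_) hc
  rcases Nat.le_one_iff_eq_zero_or_eq_one.mp hs with h | h
  · rw [Multiset.card_eq_zero.mp h, monoWord_zero]
    exact ⟨(1, 0), by funext z; simp [affineWord]⟩
  · obtain ⟨i, rfl⟩ := Multiset.card_eq_one.mp h
    exact ⟨(0, Pi.single i 1), by funext z; simp [affineWord, monoWord, Pi.single_apply]⟩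

open Classical in
lemma card_rm_one_le (m : ℕ) :
    (Finset.univ.filter fun c : Word m => c ∈ RM m 1).card ≤ 2 * 2 ^ m := by
  have h : (Finset.univ.filter fun c : Word m => c ∈ RM m 1) ⊆
      Finset.univ.image (affineWord m) := fun c hc => by
    obtain ⟨a, ha⟩ := exists_affineWord_eq (Finset.mem_filter.mp hc).2
    exact Finset.mem_image.mpr ⟨a, Finset.mem_univ _, ha⟩
  refine (Finset.card_le_card h).trans (Finset.card_image_le.trans (le_of_eq ?_))
  simp [ZMod.card]

/-- The minimum weight of the first-order Reed-Muller code. -/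
lemma le_two_mul_hammingNorm {m : ℕ} {c : Word m} (hc : c ∈ RM m 1) (h0 : c ≠ 0) :
    2 ^ m ≤ 2 * hammingNorm c := by
  obtain ⟨⟨a, l⟩, rfl⟩ := exists_affineWord_eq hc
  have hcard : (Finset.univ : Finset (Fin m → ZMod 2)).card = 2 ^ m := by simp [ZMod.card]
  by_cases hl : l = 0
  · subst hl
    have ha : a ≠ 0 := fun ha => h0 (by rw [ha]; exact (affineWord m).map_zero)
    have : hammingNorm (affineWord m (a, 0)) = 2 ^ m := by
      rw [hammingNorm, Finset.filter_true_of_mem, hcard]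
      intro z _
      simpa [affineWord] using ha
    omega
  · obtain ⟨i, hi⟩ := Function.ne_iff.mp hl
    have hi1 : l i = 1 := (eq_zero_or_one _).resolve_left hi
    -- A non-constant affine function changes value under translation by a suitable unit vector, so
    -- its zeros inject into its non-zeros.
    have hflip : ∀ z, affineWord m (a, l) (z + Pi.single i 1) = affineWord m (a, l) z + 1 := by
      intro z
      simp [affineWord, mul_add, Finset.sum_add_distrib, Pi.single_apply, hi1, add_assoc]
    have heq : (Finset.univ.filter fun z => ¬ affineWord m (a, l) z ≠ 0).card ≤
        hammingNorm (affineWord m (a, l)) := by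
      refine Finset.card_le_card_of_injOn (fun z => z + Pi.single i 1) ?_
        (add_left_injective _).injOn
      intro z hz
      have hz' : affineWord m (a, l) z = 0 := by simpa using hz
      simp [hflip, hz']
    have hsum := Finset.card_filter_add_card_filter_not (s := Finset.univ)
      (fun z => affineWord m (a, l) z ≠ 0)
    rw [hcard] at hsum
    have : hammingNorm (affineWord m (a, l)) =
      (Finset.univ.filter fun z => affineWord m (a, l) z ≠ 0).card := rfl
    omega

/-- The union bound for a nonnegative weight on a finite type. -/
lemma sum_filter_le_sum_sum_filter {α β : Type*} [Fintype α] (s : Finset β) (P : α → Prop)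
    [DecidablePred P] (Q : β → α → Prop) [∀ b, DecidablePred (Q b)] (w : α → ℝ)
    (hw : ∀ a, 0 ≤ w a) (h : ∀ a, P a → ∃ b ∈ s, Q b a) :
    ∑ a with P a, w a ≤ ∑ b ∈ s, ∑ a with Q b a, w a := by
  simp only [Finset.sum_filter]
  rw [Finset.sum_comm]
  refine Finset.sum_le_sum fun a _ => ?_
  have h0 : ∀ b ∈ s, 0 ≤ if Q b a then w a else 0 := fun b _ => by
    split_ifs
    exacts [hw a, le_rfl]
  split_ifs with hP
  · obtain ⟨b, hb, hQ⟩ := h a hP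
    exact (if_pos hQ).ge.trans (Finset.single_le_sum h0 hb)
  · exact Finset.sum_nonneg h0

/-! ### Iterated crossover probabilities -/

section PIter

lemma one_sub_two_mul_pIter (p : ℝ) (j : ℕ) : 1 - 2 * pIter p j = (1 - 2 * p) ^ 2 ^ j := by
  rw [pIter]; ring

lemma pIter_pIter (p : ℝ) (a b : ℕ) : pIter (pIter p a) b = pIter p (a + b) := by
  rw [pIter, one_sub_two_mul_pIter, pIter, ← pow_mul, ← pow_add]

variable {p : ℝ}

lemma pIter_pos (hp0 : 0 < p) (hp1 : p < 1 / 2) (j : ℕ) : 0 < pIter p j := by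
  have : (1 - 2 * p) ^ 2 ^ j < 1 := pow_lt_one₀ (by linarith) (by linarith) (by positivity)
  rw [pIter]; linarith

lemma pIter_lt_half (hp1 : p < 1 / 2) (j : ℕ) : pIter p j < 1 / 2 := by
  have : 0 < (1 - 2 * p) ^ 2 ^ j := pow_pos (by linarith) _
  rw [pIter]; linarith

lemma pIter_mono (hp0 : 0 < p) (hp1 : p < 1 / 2) {i j : ℕ} (h : i ≤ j) :
    pIter p i ≤ pIter p j := by
  have : (1 - 2 * p) ^ 2 ^ j ≤ (1 - 2 * p) ^ 2 ^ i :=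
    pow_le_pow_of_le_one (by linarith) (by linarith) (Nat.pow_le_pow_right (by norm_num) h)
  rw [pIter, pIter]; linarith

lemma log_ratio_pos (hp0 : 0 < p) (hp1 : p < 1 / 2) : 0 < Real.log ((1 - p) / p) :=
  Real.log_pos ((one_lt_div hp0).mpr (by linarith))

lemma log_ratio_anti {q : ℝ} (hp0 : 0 < p) (hpq : p ≤ q) (hq1 : q < 1 / 2) :
    Real.log ((1 - q) / q) ≤ Real.log ((1 - p) / p) := by
  have hq0 : 0 < q := hp0.trans_le hpq
  refine Real.log_le_log (div_pos (by linarith) hq0) ?_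
  rw [div_le_div_iff₀ hq0 hp0]
  nlinarith

end PIter

/-! ### Maximum likelihood decoding at the leaves -/

section FirstOrder

lemma sum_prodProb_closer_le {q : ℝ} (hq0 : 0 < q) (hq1 : q < 1 / 2) {n : ℕ} (u : Word n) :
    ∑ ν : Word n with hammingNorm (ν - u) ≤ hammingNorm ν, prodProb q ν ≤
      (2 * √(q * (1 - q))) ^ hammingNorm u := by
  have ha0 : 0 < √q := Real.sqrt_pos.mpr hq0
  have hb0 : 0 < √(1 - q) := Real.sqrt_pos.mpr (by linarith)
  have ha2 : √q * √q = q := Real.mul_self_sqrt hq0.le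
  have hb2 : √(1 - q) * √(1 - q) = 1 - q := Real.mul_self_sqrt (by linarith)
  set a := √q
  set b := √(1 - q)
  have hab : √(q * (1 - q)) = a * b := Real.sqrt_mul hq0.le _
  have hr0 : 0 < a / b := div_pos ha0 hb0
  have hr1 : a / b ≤ 1 := (div_le_one hb0).mpr (by nlinarith)
  -- The product of the `g i (ν i)` is the tilt `(a / b)` to the power `|ν - u| - |ν|`, at least `1`
  -- on the event. Each coordinate in the support of `u` has mean `(1 - q) a / b + q b / a = 2 a b`,
  -- the Bhattacharyya parameter.
  let g : (Fin n → ZMod 2) → ZMod 2 → ℝ := fun i t =>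
    if u i ≠ 0 then (if t = 1 then (a / b)⁻¹ else a / b) else 1
  have hpow : ∀ v : Word n, (a / b) ^ hammingNorm v = ∏ i, if v i ≠ 0 then a / b else 1 :=
    fun v => by rw [hammingNorm, ← Finset.prod_const, Finset.prod_filter]
  have hg : ∀ ν : Word n, (∏ i, g i (ν i)) * (a / b) ^ hammingNorm ν =
      (a / b) ^ hammingNorm (ν - u) := fun ν => by
    rw [hpow, hpow, ← Finset.prod_mul_distrib]
    refine Finset.prod_congr rfl fun i _ => ?_
    rcases eq_zero_or_one (u i) with hu | hu <;> rcases eq_zero_or_one (ν i) with hv | hv <;>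
      simp [g, hu, hv, ha0.ne', hb0.ne']
  have hg0 : ∀ ν : Word n, 0 ≤ ∏ i, g i (ν i) := fun ν => by
    refine Finset.prod_nonneg fun i _ => ?_
    simp only [g]
    split_ifs <;> positivity
  refine (sum_prodProb_filter_le hq0.le (by linarith) _ (fun ν => ∏ i, g i (ν i)) hg0 ?_).trans
    (le_of_eq ?_)
  · intro ν hν
    have h := pow_le_pow_of_le_one hr0.le hr1 hν
    rw [← hg ν] at h
    exact le_of_mul_le_mul_right (by rwa [one_mul]) (pow_pos hr0 _)
  · rw [sum_prodProb_mul_prod, hab, hammingNorm, ← Finset.prod_const, Finset.prod_filter]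
    refine Finset.prod_congr rfl fun i _ => ?_
    by_cases hu : u i = 0
    · simp [g, hu]
    · simp only [g, hu, ne_eq, not_false_eq_true, if_true, zero_ne_one, if_false]
      rw [← hb2]
      nth_rewrite 1 [← ha2]
      field_simp
      ring

/-- The error probability of maximum likelihood decoding of first-order Reed-Muller codes. -/
lemma errProbOf_firstOrder_le {D : ∀ m : ℕ, Word m → Word m} (hD : IsFirstOrderML D) {q : ℝ}
    (hq0 : 0 < q) (hq1 : q < 1 / 2) {n : ℕ} (hn : 1 ≤ n) {c : Word n} (hc : c ∈ RM n 1) :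
    errProbOf q (D n) c ≤ 2 * 2 ^ n * (2 * √(q * (1 - q))) ^ 2 ^ (n - 1) := by
  classical
  have hβ1 : 2 * √(q * (1 - q)) ≤ 1 := by
    have : √(q * (1 - q)) ≤ 1 / 2 := 
      Real.sqrt_le_iff.mpr ⟨by norm_num, by nlinarith [sq_nonneg (q - 1 / 2)]⟩
    linarith
  calc errProbOf q (D n) c
      ≤ ∑ u : Word n with u ∈ RM n 1 ∧ u ≠ 0,
          ∑ ν : Word n with hammingNorm (ν - u) ≤ hammingNorm ν, prodProb q ν := by
        refine sum_filter_le_sum_sum_filter _ _ _ _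
          (prodProb_nonneg hq0.le (by linarith)) fun ν hν => ?_
        have h := hD n (c + ν)
        -- The difference between the decoded and the sent codeword is a nonzero codeword at least
        -- as close to `ν` as zero is.
        refine ⟨D n (c + ν) - c, Finset.mem_filter.mpr ⟨Finset.mem_univ _,
          (rmSubmodule n 1).sub_mem h.1 hc, sub_ne_zero.mpr hν⟩, ?_⟩
        have h2 := h.2 c hc
        rw [hammingDist_comm, hammingDist_eq_hammingNorm, hammingDist_comm,
          hammingDist_eq_hammingNorm, neg_add_cancel_left] at h2
        rwa [show ν - (D n (c + ν) - c) = -D n (c + ν) + (c + ν) by abel]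
    _ ≤ ∑ u : Word n with u ∈ RM n 1 ∧ u ≠ 0, (2 * √(q * (1 - q))) ^ 2 ^ (n - 1) := by
        refine Finset.sum_le_sum fun u hu => ?_
        obtain ⟨hu, hu0⟩ := (Finset.mem_filter.mp hu).2
        refine (sum_prodProb_closer_le hq0 hq1 u).trans
          (pow_le_pow_of_le_one (by positivity) hβ1 ?_)
        have h := le_two_mul_hammingNorm hu hu0
        obtain ⟨l, rfl⟩ := Nat.exists_eq_add_of_le' hn
        rw [pow_succ] at h
        rw [Nat.add_sub_cancel]
        omega
    _ ≤ 2 * 2 ^ n * (2 * √(q * (1 - q))) ^ 2 ^ (n - 1) := by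
        rw [Finset.sum_const, nsmul_eq_mul]
        gcongr
        have h : (Finset.univ.filter fun u : Word n => u ∈ RM n 1 ∧ u ≠ 0).card ≤ 2 * 2 ^ n :=
          (Finset.card_le_card (Finset.monotone_filter_right _ fun _ _ h => h.1)).trans
            (card_rm_one_le n)
        exact_mod_cast h

/-- With `x = y^(2K)` and `l = -log (1 - x)`, Bernoulli's inequality gives `1 - x ≤ 2K (1 - y)`, so
the logarithm on the left is at most `log (4K) + l ≤ 2K + l`. Then `x ≤ l` and `x ≤ 1` give `(2K +
l) x ≤ 4K l`. -/
lemma log_mul_sq_le {y : ℝ} (hy0 : 0 < y) (hy1 : y < 1) {K : ℕ} (hK : 1 ≤ K) :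
    Real.log ((1 + y) / (1 - y)) * (y ^ K) ^ 2 / (4 * K) ≤ -Real.log (1 - (y ^ K) ^ 2) := by
  have hK' : (1 : ℝ) ≤ K := by exact_mod_cast hK
  have hx1 : (y ^ K) ^ 2 < 1 := by
    rw [← pow_mul]; exact pow_lt_one₀ hy0.le hy1 (by omega)
  have hx0 : 0 < (y ^ K) ^ 2 := by positivity
  have hbern : 1 - (y ^ K) ^ 2 ≤ 2 * K * (1 - y) := by
    have h := one_add_mul_le_pow (show (-2 : ℝ) ≤ y - 1 by linarith) (K * 2)
    rw [add_sub_cancel, pow_mul] at h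
    push_cast at h
    linarith
  set x := (y ^ K) ^ 2
  have hu : 0 < 1 - x := by linarith
  have hlog : Real.log ((1 + y) / (1 - y)) ≤ Real.log (4 * K) - Real.log (1 - x) := by
    rw [← Real.log_div (by positivity) hu.ne']
    refine Real.log_le_log (div_pos (by linarith) (by linarith)) ?_
    rw [div_le_div_iff₀ (by linarith) hu]
    nlinarith
  have h4K : Real.log (4 * K) ≤ 2 * K := by
    have h1 := Real.log_le_sub_one_of_pos (show (0 : ℝ) < 2 * K by positivity)
    have h2 := Real.log_le_sub_one_of_pos (show (0 : ℝ) < 2 by norm_num)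
    have h3 : Real.log (4 * K) = Real.log 2 + Real.log (2 * K) := by
      rw [← Real.log_mul (by norm_num) (by positivity)]; congr 1; ring
    linarith
  have hxl : x ≤ -Real.log (1 - x) := by
    have := Real.log_le_sub_one_of_pos hu; linarith
  rw [div_le_iff₀ (by positivity)]
  set l := -Real.log (1 - x)
  calc _ ≤ (2 * K + l) * x := by
        refine mul_le_mul_of_nonneg_right ?_ hx0.le
        linarith
    _ ≤ l * (4 * K) := by nlinarith

/-- The first-order error term is dominated by the error terms of the aggregation steps. -/
lemma bhattacharyya_pow_le {p ε : ℝ} (hp0 : 0 < p) (hp1 : p < 1 / 2) {n : ℕ} (hn : 1 ≤ n) (k : ℕ)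
    (hε0 : 0 < ε) (hε : ε ≤ 1 / 2 - pIter p k) :
    (2 * √(pIter p k * (1 - pIter p k))) ^ 2 ^ (n - 1) ≤
      Real.exp (-(ε ^ 2 * Real.log ((1 - p) / p) * 2 ^ n / (4 * 2 ^ k))) := by
  have hq0 := pIter_pos hp0 hp1 k
  have hq1 := pIter_lt_half hp1 k
  have hkey := log_mul_sq_le (show 0 < 1 - 2 * p by linarith) (by linarith)
    (K := 2 ^ k) Nat.one_le_two_pow
  rw [← one_sub_two_mul_pIter, show (1 + (1 - 2 * p)) / (1 - (1 - 2 * p)) = (1 - p) / p by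
    rw [show 1 + (1 - 2 * p) = 2 * (1 - p) by ring, show 1 - (1 - 2 * p) = 2 * p by ring,
      mul_div_mul_left _ _ two_ne_zero]] at hkey
  have hL := log_ratio_pos hp0 hp1
  set q := pIter p k
  set L := Real.log ((1 - p) / p)
  have hqq : 0 < q * (1 - q) := mul_pos hq0 (by linarith)
  have hβ : 0 < 2 * √(q * (1 - q)) := by positivity
  have hβ2 : 1 - (1 - 2 * q) ^ 2 = (2 * √(q * (1 - q))) ^ 2 := by
    rw [mul_pow, Real.sq_sqrt hqq.le]; ring
  rw [hβ2, Real.log_pow] at hkey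
  rw [← Real.exp_log (pow_pos hβ _), Real.log_pow]
  apply Real.exp_le_exp.mpr
  obtain ⟨l, rfl⟩ := Nat.exists_eq_add_of_le' hn
  rw [Nat.add_sub_cancel, pow_succ 2 l]
  push_cast at hkey ⊢
  -- The hypothesis reads `ε^2 ≤ (1 - 2q)^2 / 4`; this `1/4` accounts for the square in `hβ2` and
  -- for `2^(n-1)` against `2^n`.
  have h1 : ε ^ 2 * L / (4 * 2 ^ k) ≤ 1 / 4 * (L * (1 - 2 * q) ^ 2 / (4 * 2 ^ k)) := by
    have h : ε ^ 2 ≤ (1 / 2 - q) ^ 2 := by gcongr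
    calc ε ^ 2 * L / (4 * 2 ^ k) ≤ (1 / 2 - q) ^ 2 * L / (4 * 2 ^ k) := by gcongr
      _ = _ := by ring
  have h2 : ε ^ 2 * L * (2 ^ l * 2) / (4 * 2 ^ k) = 2 ^ l * 2 * (ε ^ 2 * L / (4 * 2 ^ k)) := by
    ring
  rw [h2]
  have h3 : (0 : ℝ) < 2 ^ l := by positivity
  nlinarith

end FirstOrder

/-! ### Majority votes -/

section Aggregation

variable {k : ℕ} (e : CosetIndexing k) {m : ℕ}

/-- The points of the coset `x + B` other than `x`. -/
def puncturedCoset (B : KSubspace k m) (x : Fin m → ZMod 2) : Finset (Fin m → ZMod 2) :=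
  (Finset.univ.filter fun y => cosetIndex e B y = cosetIndex e B x).erase x

lemma card_puncturedCoset (B : KSubspace k m) (x : Fin m → ZMod 2) :
    (puncturedCoset e B x).card = 2 ^ k - 1 := by
  rw [puncturedCoset, Finset.card_erase_of_mem (by simp), card_coset]

lemma project_cosetIndex (B : KSubspace k m) (x : Fin m → ZMod 2) (ν : Word m) :
    project e B ν (cosetIndex e B x) = ν x + ∑ y ∈ puncturedCoset e B x, ν y := by
  rw [project, puncturedCoset, Finset.add_sum_erase _ _ (by simp)]

/-- The number of subspaces `B` for which the noise has odd parity on `x + B` without `x`, i.e. for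
which the correctly decoded projection gives wrong evidence on the noise at `x`. -/
noncomputable def wrongVotes (x : Fin m → ZMod 2) (ν : Word m) : ℝ :=
  ∑ B : KSubspace k m, if ∑ y ∈ puncturedCoset e B x, ν y = 1 then 1 else 0

lemma sum_prodProb_mul_wrongVotes (p : ℝ) (x : Fin m → ZMod 2) :
    ∑ ν, prodProb p ν * wrongVotes e x ν =
      Fintype.card (KSubspace k m) * ((1 - (1 - 2 * p) ^ (2 ^ k - 1)) / 2) := by
  simp only [wrongVotes, Finset.mul_sum]
  rw [Finset.sum_comm, ← nsmul_eq_mul, ← Finset.card_univ, ← Finset.sum_const]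
  refine Finset.sum_congr rfl fun B _ => ?_
  have h := sum_prodProb_parity p (puncturedCoset e B x) 1
  rw [bitProb_one, card_puncturedCoset, Finset.sum_filter] at h
  simpa using h

/-- Changing the noise at `i` affects only the subspaces containing `i - x`, and none if `i = x`. -/
lemma abs_wrongVotes_update_sub_le (x : Fin m → ZMod 2) (ν : Word m) (i : Fin m → ZMod 2)
    (b : ZMod 2) :
    |wrongVotes e x (Function.update ν i b) - wrongVotes e x ν| ≤
      Fintype.card (KSubspace k m) * (2 ^ k / 2 ^ m) := by
  classical
  have hB : ∀ B : KSubspace k m,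
      |(if ∑ y ∈ puncturedCoset e B x, Function.update ν i b y = 1 then (1 : ℝ) else 0) -
        if ∑ y ∈ puncturedCoset e B x, ν y = 1 then 1 else 0| ≤
      if i ≠ x ∧ i - x ∈ B.1 then 1 else 0 := by
    intro B
    by_cases hi : i ∈ puncturedCoset e B x
    · have h := hi
      rw [puncturedCoset, Finset.mem_erase, Finset.mem_filter, cosetIndex_eq_iff] at h
      rw [if_pos (show i ≠ x ∧ i - x ∈ B.1 from ⟨h.1, h.2.2⟩)]
      split_ifs <;> norm_num
    · rw [Finset.sum_update_of_notMem hi, sub_self, abs_zero]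
      split_ifs <;> norm_num
  rw [wrongVotes, wrongVotes, ← Finset.sum_sub_distrib]
  refine (Finset.abs_sum_le_sum_abs _ _).trans ((Finset.sum_le_sum fun B _ => hB B).trans ?_)
  by_cases hix : i = x
  · simp only [hix, ne_eq, not_true_eq_false, false_and, if_false, Finset.sum_const_zero]
    positivity
  · simp only [ne_eq, hix, not_false_eq_true, true_and]
    rw [← Finset.sum_filter, Finset.sum_const, nsmul_eq_mul, mul_one, ← mul_div_assoc,
      le_div_iff₀ (by positivity), mul_comm (Fintype.card (KSubspace k m) : ℝ)]
    exact card_kSubspace_mem_mul_le (sub_ne_zero.mpr hix)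

/-- Concentration of the number of wrong votes. -/
lemma sum_prodProb_wrongVotes_le {p L ε : ℝ} (hk : 1 ≤ k) (hkm : k ≤ m) (hp0 : 0 < p)
    (hp1 : p < 1 / 2) (hL0 : 0 < L) (hL : L ≤ Real.log ((1 - p) / p)) (hε0 : 0 < ε)
    (hε : ε ≤ (1 - 2 * p) ^ (2 ^ k - 1) / 2) (x : Fin m → ZMod 2) :
    ∑ ν with (Fintype.card (KSubspace k m) : ℝ) / 2 ≤ wrongVotes e x ν, prodProb p ν ≤
      Real.exp (-(ε ^ 2 * L * 2 ^ m / (4 * (2 ^ k) ^ 2))) := by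
  have hG : (0 : ℝ) < Fintype.card (KSubspace k m) := by
    rw [card_kSubspace hkm]; exact zero_lt_one.trans_le (one_le_gaussBinom hkm)
  have hmean := sum_prodProb_mul_wrongVotes e p x
  have hdiff := abs_wrongVotes_update_sub_le e x
  set G : ℝ := ((Fintype.card (KSubspace k m) : ℕ) : ℝ)
  have hK : (2 : ℝ) ≤ 2 ^ k := by simpa using pow_le_pow_right₀ (show (1 : ℝ) ≤ 2 by norm_num) hk
  have hε2 : ε ≤ 1 / 2 := hε.trans (by
    have : (1 - 2 * p) ^ (2 ^ k - 1) ≤ 1 := pow_le_one₀ (by linarith) (by linarith)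
    linarith)
  set K : ℝ := 2 ^ k
  set N : ℝ := 2 ^ m with hN
  have hN0 : 0 < N := by positivity
  have hK0 : 0 < K := by linarith
  -- The minimiser of the Chernoff exponent `lam^2 K^2 / (N L) - lam ε`; `c = lam K / N` is the
  -- resulting bounded difference, and `c ≤ L / 8` follows from `ε ≤ 1/2` and `K ≥ 2`.
  set lam : ℝ := ε * L * N / (2 * K ^ 2) with hlam
  have hlam0 : 0 < lam := by positivity
  set c : ℝ := ε * L / (2 * K) with hc
  have hcL : c ≤ L / 8 := by
    rw [hc, div_le_div_iff₀ (by positivity) (by norm_num)]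
    nlinarith
  have hmc := sum_prodProb_exp_le hp0 hp1 hL0 hL hcL (fun ν => lam / G * wrongVotes e x ν)
    fun ν i b => by
      rw [← mul_sub, abs_mul, abs_of_pos (div_pos hlam0 hG)]
      refine (mul_le_mul_of_nonneg_left (hdiff ν i b) (div_pos hlam0 hG).le).trans (le_of_eq ?_)
      rw [hc, hlam]
      field_simp
  have hcardN : (Fintype.card (Fin m → ZMod 2) : ℝ) = N := by simp [hN, ZMod.card]
  have hE : ∑ ν, prodProb p ν * (lam / G * wrongVotes e x ν) ≤ lam * (1 / 2 - ε) := by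
    have h1 : ∑ ν, prodProb p ν * (lam / G * wrongVotes e x ν) =
        lam / G * ∑ ν, prodProb p ν * wrongVotes e x ν := by
      rw [Finset.mul_sum]
      exact Finset.sum_congr rfl fun ν _ => by ring
    rw [h1, hmean, ← mul_assoc, div_mul_cancel₀ _ hG.ne']
    gcongr
    linarith
  calc ∑ ν with G / 2 ≤ wrongVotes e x ν, prodProb p ν
      ≤ ∑ ν, prodProb p ν * Real.exp (lam / G * wrongVotes e x ν - lam / 2) := by
        refine sum_prodProb_filter_le hp0.le (by linarith) _ _ (fun _ => (Real.exp_pos _).le)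
          fun ν hν => Real.one_le_exp ?_
        have := mul_le_mul_of_nonneg_left hν (div_pos hlam0 hG).le
        have h2 : lam / G * (G / 2) = lam / 2 := by field_simp
        linarith
    _ = (∑ ν, prodProb p ν * Real.exp (lam / G * wrongVotes e x ν)) * Real.exp (-(lam / 2)) := by
        rw [Finset.sum_mul]
        exact Finset.sum_congr rfl fun ν _ => by rw [sub_eq_add_neg, Real.exp_add, mul_assoc]
    _ ≤ Real.exp (N * (c ^ 2 / L) + lam * (1 / 2 - ε)) * Real.exp (-(lam / 2)) := by
        gcongr
        refine hmc.trans (Real.exp_le_exp.mpr ?_)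
        rw [hcardN]
        linarith
    _ = _ := by
        rw [← Real.exp_add]
        congr 1
        rw [hc, hlam]
        field_simp
        ring

lemma disagreements_eq (c ν : Word m) (x : Fin m → ZMod 2) :
    disagreements e (c + ν) (fun B => project e B c) x =
      (Finset.univ.filter fun B : KSubspace k m =>
        ν x + ∑ y ∈ puncturedCoset e B x, ν y ≠ 0).card := by
  rw [disagreements, Finset.card_filter]
  refine Finset.sum_congr rfl fun B _ => ?_
  rw [project_add, Pi.add_apply, project_cosetIndex e B x ν]
  simp

lemma aggregate_eq_self (c : Word m) : aggregate e c (fun B => project e B c) = c := by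
  have h : ∀ x, disagreements e c (fun B => project e B c) x = 0 := fun x => by
    simp [disagreements]
  funext x
  rw [aggregate, h, if_neg, add_zero]
  rw [not_lt, Nat.cast_zero]
  positivity

/-- If all the projections are decoded correctly and less than half of the votes at every position
are wrong, then the aggregation step recovers the codeword. -/
lemma aggregate_add_eq (c ν : Word m)
    (h : ∀ x, wrongVotes e x ν < (Fintype.card (KSubspace k m) : ℝ) / 2) :
    aggregate e (c + ν) (fun B => project e B c) = c := by
  have hW : ∀ x, wrongVotes e x ν = ((Finset.univ.filter fun B : KSubspace k m =>
      ∑ y ∈ puncturedCoset e B x, ν y = 1).card : ℝ) := fun x => by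
    rw [wrongVotes, Finset.card_filter]; push_cast; rfl
  funext x
  have hx := h x
  rw [hW x] at hx
  rw [aggregate, disagreements_eq, Pi.add_apply]
  -- If `ν x = 0` the votes to flip are the wrong ones; if `ν x = 1` they are the right ones, and
  -- strictness is needed because a tie does not flip.
  rcases eq_zero_or_one (ν x) with hν | hν
  · have hset : (Finset.univ.filter fun B : KSubspace k m =>
        ν x + ∑ y ∈ puncturedCoset e B x, ν y ≠ 0) = Finset.univ.filter fun B : KSubspace k m =>
        ∑ y ∈ puncturedCoset e B x, ν y = 1 := by
      refine Finset.filter_congr fun B _ => ?_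
      rw [hν, zero_add]
      exact ⟨fun h => (eq_zero_or_one _).resolve_left h, fun h => h ▸ one_ne_zero⟩
    rw [hset, if_neg, hν, add_zero, add_zero]
    rw [not_lt, le_div_iff₀ two_pos]
    rw [lt_div_iff₀ two_pos] at hx
    exact_mod_cast hx.le
  · have hset : (Finset.univ.filter fun B : KSubspace k m =>
        ν x + ∑ y ∈ puncturedCoset e B x, ν y ≠ 0) = Finset.univ.filter fun B : KSubspace k m =>
        ¬ ∑ y ∈ puncturedCoset e B x, ν y = 1 := by
      refine Finset.filter_congr fun B _ => ?_
      rw [hν]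
      generalize ∑ y ∈ puncturedCoset e B x, ν y = t
      revert t
      decide
    have hsum := Finset.card_filter_add_card_filter_not (s := Finset.univ)
      (fun B : KSubspace k m => ∑ y ∈ puncturedCoset e B x, ν y = 1)
    rw [Finset.card_univ] at hsum
    rw [hset, if_pos, hν, add_assoc, (by decide : (1 + 1 : ZMod 2) = 0), add_zero]
    rw [← hsum] at hx ⊢
    push_cast at hx ⊢
    have hx' : ((Finset.univ.filter fun B : KSubspace k m =>
        ∑ y ∈ puncturedCoset e B x, ν y = 1).card : ℝ) <
        (Finset.univ.filter fun B : KSubspace k m =>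
          ¬ ∑ y ∈ puncturedCoset e B x, ν y = 1).card := by linarith
    have hx'' : ((Finset.univ.filter fun B : KSubspace k m =>
        ∑ y ∈ puncturedCoset e B x, ν y = 1).card : ℚ) <
        (Finset.univ.filter fun B : KSubspace k m =>
          ¬ ∑ y ∈ puncturedCoset e B x, ν y = 1).card := by exact_mod_cast hx'
    linarith

end Aggregation

/-! ### The recursive decoder -/

section Decoder

lemma iterateUntilStable_of_fixed {m : ℕ} {step : Word m → Word m} {c : Word m}
    (h : step c = c) (M : ℕ) : iterateUntilStable step M c = c := by
  cases M with
  | zero => rfl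
  | succ M => rw [iterateUntilStable, h, if_pos rfl]

lemma iterateUntilStable_eq {m : ℕ} {step : Word m → Word m} {c Y : Word m} {M : ℕ} (hM : 1 ≤ M)
    (hc : step c = c) (hY : step Y = c) : iterateUntilStable step M Y = c := by
  obtain ⟨M, rfl⟩ := Nat.exists_eq_add_of_le' hM
  rw [iterateUntilStable, hY]
  split_ifs with h
  · exact h
  · exact iterateUntilStable_of_fixed hc M

variable {k : ℕ} (e : CosetIndexing k) {D : ∀ m : ℕ, Word m → Word m}

lemma IsFirstOrderML.apply_codeword (hD : IsFirstOrderML D) {m : ℕ} {c : Word m}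
    (hc : c ∈ RM m 1) : D m c = c := by
  have h := (hD m c).2 c hc
  rw [hammingDist_self, Nat.le_zero, hammingDist_eq_zero] at h
  exact h.symm

/-- Codewords are fixed by the decoder. -/
lemma rpaAux_apply_codeword (hD : IsFirstOrderML D) (M d : ℕ) {m : ℕ} {c : Word m}
    (hc : c ∈ RM m (d * k + 1)) : rpaAux e D M d m c = c := by
  induction d generalizing m with
  | zero => exact hD.apply_codeword (by simpa using hc)
  | succ d ih =>
    refine iterateUntilStable_of_fixed ?_ M
    have hB : ∀ B : KSubspace k m, rpaAux e D M d (m - k) (project e B c) = project e B c :=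
      fun B => ih (project_mem_rm e B (by rwa [show d * k + 1 + k = (d + 1) * k + 1 by ring]))
    simp only [hB, aggregate_eq_self]

/-- One level of the recursion for the error probability. -/
lemma errProbOf_rpaAux_succ_le (hD : IsFirstOrderML D) {M : ℕ} (hM : 1 ≤ M) (d : ℕ) {p : ℝ}
    (hp0 : 0 < p) (hp1 : p < 1 / 2) {m : ℕ} {c : Word m} (hc : c ∈ RM m ((d + 1) * k + 1)) :
    errProbOf p (rpaAux e D M (d + 1) m) c ≤
      ∑ B : KSubspace k m, errProbOf (pIter p k) (rpaAux e D M d (m - k)) (project e B c) +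
      ∑ x : Fin m → ZMod 2,
        ∑ ν with (Fintype.card (KSubspace k m) : ℝ) / 2 ≤ wrongVotes e x ν, prodProb p ν := by
  classical
  have hcB : ∀ B : KSubspace k m, project e B c ∈ RM (m - k) (d * k + 1) :=
    fun B => project_mem_rm e B (by rwa [show d * k + 1 + k = (d + 1) * k + 1 by ring])
  have hproj : ∀ B : KSubspace k m,
      errProbOf (pIter p k) (rpaAux e D M d (m - k)) (project e B c) =
      ∑ ν with rpaAux e D M d (m - k) (project e B c + project e B ν) ≠ project e B c,
        prodProb p ν := fun B => by
    have h := sum_prodProb_parity_blocks p (cosetIndex e B) (2 ^ k) (card_coset e B)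
      (fun μ => if rpaAux e D M d (m - k) (project e B c + μ) ≠ project e B c then 1 else 0)
    simp only [mul_ite, mul_one, mul_zero, ← Finset.sum_filter] at h
    exact h.symm
  simp only [hproj]
  -- The bad events of one iteration: a projection decoded wrongly, or a position where wrong votes
  -- are not a strict minority. Outside them the first iteration already gives `c`.
  let Q : KSubspace k m ⊕ (Fin m → ZMod 2) → Word m → Prop := Sum.elim
    (fun B ν => rpaAux e D M d (m - k) (project e B c + project e B ν) ≠ project e B c)
    (fun x ν => (Fintype.card (KSubspace k m) : ℝ) / 2 ≤ wrongVotes e x ν)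
  refine (sum_filter_le_sum_sum_filter Finset.univ _ Q _
    (prodProb_nonneg hp0.le (by linarith)) fun ν hν => ?_).trans (le_of_eq ?_)
  · by_contra hcon
    refine hν (iterateUntilStable_eq hM ?_ ?_)
    · simp only [rpaAux_apply_codeword e hD M d (hcB _), aggregate_eq_self]
    · have h1 : ∀ B : KSubspace k m,
          rpaAux e D M d (m - k) (project e B (c + ν)) = project e B c := fun B => by
        by_contra h
        rw [project_add] at h
        exact hcon ⟨Sum.inl B, Finset.mem_univ _, h⟩
      simp only [h1]
      refine aggregate_add_eq e c ν fun x => ?_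
      by_contra h
      exact hcon ⟨Sum.inr x, Finset.mem_univ _, not_lt.mp h⟩
  · rw [Fintype.sum_sum_type]
    congr!

end Decoder

/-! ### Solving the recursion -/

/-- The error probability of the recursive decoder for a transmitted codeword, at depth `d` of a
recursion of total depth `d₀` that ends with first-order codes of length `2 ^ n`. -/
lemma errProbOf_rpaAux_le {p : ℝ} (hp0 : 0 < p) (hp1 : p < 1 / 2) {k : ℕ} (hk : 1 ≤ k)
    (e : CosetIndexing k) {D : ∀ m : ℕ, Word m → Word m} (hD : IsFirstOrderML D) {M : ℕ}
    (hM : 1 ≤ M) {n d₀ : ℕ} (hn : 1 ≤ n) (hd₀ : 1 ≤ d₀) {ε : ℝ} (hε0 : 0 < ε)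
    (hε : ε ≤ 1 / 2 - pIter p (d₀ * k)) (d j m : ℕ) (hdj : j + d = d₀) (hm : m = n + d * k)
    (c : Word m) (hc : c ∈ RM m (d * k + 1)) :
    errProbOf (pIter p (j * k)) (rpaAux e D M d m) c ≤
      gaussBinom (n + d₀ * k) k ^ d * ((d + 2) * 2 ^ m *
        Real.exp (-(ε ^ 2 * Real.log ((1 - pIter p ((d₀ - 1) * k)) / pIter p ((d₀ - 1) * k)) *
          2 ^ n / (4 * 2 ^ k)))) := by
  have hq0 := pIter_pos hp0 hp1 ((d₀ - 1) * k)
  have hq1 := pIter_lt_half hp1 ((d₀ - 1) * k)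
  have hlast : pIter (pIter p ((d₀ - 1) * k)) k = pIter p (d₀ * k) := by
    rw [pIter_pIter, ← Nat.succ_mul, Nat.succ_eq_add_one, Nat.sub_add_cancel hd₀]
  have hbase := bhattacharyya_pow_le hq0 hq1 hn k hε0 (by rwa [hlast])
  rw [hlast] at hbase
  have hL0 := log_ratio_pos hq0 hq1
  have hanti : ∀ i ≤ d₀ - 1, Real.log ((1 - pIter p ((d₀ - 1) * k)) / pIter p ((d₀ - 1) * k)) ≤
      Real.log ((1 - pIter p (i * k)) / pIter p (i * k)) := fun i hi =>
    log_ratio_anti (pIter_pos hp0 hp1 _) (pIter_mono hp0 hp1 (Nat.mul_le_mul_right k hi)) hq1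
  set L := Real.log ((1 - pIter p ((d₀ - 1) * k)) / pIter p ((d₀ - 1) * k))
  set X := Real.exp (-(ε ^ 2 * L * 2 ^ n / (4 * 2 ^ k)))
  have hX0 : 0 < X := Real.exp_pos _
  set G := gaussBinom (n + d₀ * k) k
  have hG : ∀ i, 1 ≤ i → i ≤ d₀ → k ≤ n + i * k ∧ gaussBinom (n + i * k) k ≤ G := fun i h1 hi => by
    have hki : k ≤ n + i * k := le_add_left (Nat.le_mul_of_pos_left k h1)
    exact ⟨hki, gaussBinom_mono hki (Nat.add_le_add_left (Nat.mul_le_mul_right k hi) n)⟩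
  have hG1 : 1 ≤ G := one_le_gaussBinom (hG d₀ hd₀ le_rfl).1
  induction d generalizing j m with
  | zero =>
    obtain rfl : j = d₀ := hdj
    obtain rfl : m = n := by simpa using hm
    have h := errProbOf_firstOrder_le hD (pIter_pos hp0 hp1 (j * k)) (pIter_lt_half hp1 (j * k))
      hn (by simpa using hc)
    refine h.trans ?_
    rw [pow_zero, one_mul, Nat.cast_zero, zero_add]
    gcongr
  | succ d ih =>
    have hj1 : j + 1 + d = d₀ := by omega
    have hmk : m - k = n + d * k := by
      rw [hm, Nat.succ_mul, ← add_assoc, Nat.add_sub_cancel]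
    have hkm := hG (d + 1) (by omega) (by omega)
    rw [← hm] at hkm
    have hpj0 := pIter_pos hp0 hp1 (j * k)
    have hpj1 := pIter_lt_half hp1 (j * k)
    have hpk : pIter (pIter p (j * k)) k = pIter p ((j + 1) * k) := by
      rw [pIter_pIter, Nat.succ_mul]
    -- Only the mean at level `j` is at stake: `1/2 - p^((j+1)k)` is half the `2^k`-th power of `1 -
    -- 2 p^(jk)`, hence at most half its `(2^k - 1)`-th power, and it decreases in `j`.
    have hεj : ε ≤ (1 - 2 * pIter p (j * k)) ^ (2 ^ k - 1) / 2 := by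
      have h1 : pIter p ((j + 1) * k) ≤ pIter p (d₀ * k) :=
        pIter_mono hp0 hp1 (Nat.mul_le_mul_right k (by omega))
      have h2 := one_sub_two_mul_pIter (pIter p (j * k)) k
      rw [hpk] at h2
      have h3 : (1 - 2 * pIter p (j * k)) ^ 2 ^ k ≤ (1 - 2 * pIter p (j * k)) ^ (2 ^ k - 1) :=
        pow_le_pow_of_le_one (by linarith) (by linarith) (Nat.sub_le _ _)
      linarith
    have hconc : ∀ x, ∑ ν with (Fintype.card (KSubspace k m) : ℝ) / 2 ≤ wrongVotes e x ν,
        prodProb (pIter p (j * k)) ν ≤ X := fun x => by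
      refine (sum_prodProb_wrongVotes_le e hk hkm.1 hpj0 hpj1 hL0 (hanti j (by omega)) hε0 hεj
        x).trans (Real.exp_le_exp.mpr (neg_le_neg ?_))
      rw [div_le_div_iff₀ (by positivity) (by positivity)]
      -- At every aggregation `m ≥ n + k`, with equality at the last one, which therefore has the
      -- worst exponent.
      have hpow : (2 : ℝ) ^ n * 2 ^ k ≤ 2 ^ m := by
        rw [← pow_add]
        refine pow_le_pow_right₀ (by norm_num) ?_
        rw [hm]
        exact Nat.add_le_add_left (Nat.le_mul_of_pos_left k (by omega)) n
      calc ε ^ 2 * L * 2 ^ n * (4 * (2 ^ k) ^ 2)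
          = ε ^ 2 * L * (4 * 2 ^ k) * (2 ^ n * 2 ^ k) := by ring
        _ ≤ ε ^ 2 * L * (4 * 2 ^ k) * 2 ^ m := by gcongr
        _ = _ := by ring
    have hrec : ∀ B : KSubspace k m, errProbOf (pIter (pIter p (j * k)) k)
        (rpaAux e D M d (m - k)) (project e B c) ≤ G ^ d * ((d + 2) * 2 ^ m * X) := fun B => by
      rw [hpk]
      refine (ih (j + 1) (m - k) hj1 hmk (project e B c) (project_mem_rm e B
        (by rwa [show d * k + 1 + k = (d + 1) * k + 1 by ring]))).trans ?_
      have : (2 : ℝ) ^ (m - k) ≤ 2 ^ m := pow_le_pow_right₀ (by norm_num) (Nat.sub_le _ _)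
      gcongr
    calc _ ≤ ∑ B : KSubspace k m, G ^ d * ((d + 2) * 2 ^ m * X) +
          ∑ _x : Fin m → ZMod 2, X :=
          (errProbOf_rpaAux_succ_le e hD hM d hpj0 hpj1 hc).trans
            (add_le_add (Finset.sum_le_sum fun B _ => hrec B)
              (Finset.sum_le_sum fun x _ => hconc x))
      _ = gaussBinom m k * (G ^ d * ((d + 2) * 2 ^ m * X)) + 2 ^ m * X := by
          simp [card_kSubspace hkm.1, ZMod.card]
      _ ≤ G * (G ^ d * ((d + 2) * 2 ^ m * X)) + G ^ (d + 1) * (2 ^ m * X) := by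
          refine add_le_add (mul_le_mul_of_nonneg_right hkm.2 (by positivity)) ?_
          exact le_mul_of_one_le_left (by positivity) (one_le_pow₀ hG1)
      _ = _ := by push_cast; ring

lemma errProb_le_of_forall {p b : ℝ} {m r : ℕ} {dec : Word m → Word m}
    (h : ∀ c ∈ RM m r, errProbOf p dec c ≤ b) : errProb p m r dec ≤ b := by
  classical
  have hcard : ((RM m r).ncard : ℝ) = (Finset.univ.filter fun c : Word m => c ∈ RM m r).card := by
    rw [Set.ncard_eq_toFinset_card', ← Set.filter_mem_univ_eq_toFinset]
  have hpos : 0 < (Finset.univ.filter fun c : Word m => c ∈ RM m r).card :=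
    Finset.card_pos.mpr ⟨0, Finset.mem_filter.mpr ⟨Finset.mem_univ _, (rmSubmodule m r).zero_mem⟩⟩
  rw [errProb, hcard, div_le_iff₀ (by exact_mod_cast hpos), mul_comm, ← nsmul_eq_mul]
  convert Finset.sum_le_card_nsmul _ _ b fun c hc => h c (Finset.mem_filter.mp hc).2

end RPA

theorem theorem2
    (p : ℝ) (hp0 : 0 < p) (hp1 : p < 1 / 2)
    (m r k : ℕ) (hr : 2 ≤ r) (hrm : r ≤ m) (hk : k ∣ r - 1)
    (e : RPA.CosetIndexing k)
    (D : ∀ n : ℕ, RPA.Word n → RPA.Word n) (hD : RPA.IsFirstOrderML D)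
    (Miter : ℕ) (hM : 1 ≤ Miter)
    (ε : ℝ) (hε0 : 0 < ε) (hε1 : ε < RPA.eta (RPA.pIter p (r - 2))) :
    RPA.errProb p m r (RPA.rpa e D Miter m r) ≤
      64 * ((2 : ℝ) ^ m) ^ 3 * RPA.gaussBinom m k ^ ((r - 1) / k) *
        Real.exp (-Real.log ((1 - RPA.pIter p (r - k - 1)) / RPA.pIter p (r - k - 1)) *
          (2 : ℝ) ^ (-(r : ℤ) - 1 - (k : ℤ)) * (2 : ℝ) ^ m * ε ^ 2) := by
  obtain ⟨d, hd⟩ := hk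
  have hk1 : 1 ≤ k := Nat.pos_of_ne_zero fun h => by subst h; omega
  have hd1 : 1 ≤ d := Nat.pos_of_ne_zero fun h => by subst h; omega
  have hr1 : r = d * k + 1 := by rw [mul_comm]; omega
  obtain ⟨l, rfl⟩ := Nat.exists_eq_add_of_le' hrm
  have hdiv : (r - 1) / k = d := by rw [hd, Nat.mul_div_cancel_left d hk1]
  have hm : l + r = l + 1 + d * k := by omega
  have hrk : r - k - 1 = (d - 1) * k := by rw [Nat.sub_mul, hr1]; omega
  -- `η(a) = (1 - 2a)^2 / 2 = 1/2 - pIter a 1`, and `r - 2 + 1 = d * k`.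
  have hε : ε ≤ 1 / 2 - RPA.pIter p (d * k) := by
    have h1 := RPA.one_sub_two_mul_pIter (RPA.pIter p (r - 2)) 1
    rw [RPA.pIter_pIter, show r - 2 + 1 = d * k by omega] at h1
    rw [pow_one] at h1
    rw [RPA.eta] at hε1
    linarith
  refine RPA.errProb_le_of_forall fun c hc => ?_
  -- The leaves have length `2^(l+1) = 2^(m-r+1)`, so that `2^(l+1) / (4 * 2^k) = 2^(-r-1-k) N`.
  have h := RPA.errProbOf_rpaAux_le hp0 hp1 hk1 e hD hM (Nat.le_add_left 1 l) hd1 hε0 hε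
    d 0 (l + r) (zero_add d) hm c (by rwa [← hr1])
  rw [zero_mul, ← hm, show RPA.pIter p 0 = p by rw [RPA.pIter]; ring, ← hrk] at h
  rw [RPA.rpa, hdiv]
  refine h.trans ?_
  have hexp : -Real.log ((1 - RPA.pIter p (r - k - 1)) / RPA.pIter p (r - k - 1)) *
      (2 : ℝ) ^ (-(r : ℤ) - 1 - (k : ℤ)) * (2 : ℝ) ^ (l + r) * ε ^ 2 =
      -(ε ^ 2 * Real.log ((1 - RPA.pIter p (r - k - 1)) / RPA.pIter p (r - k - 1)) *
        2 ^ (l + 1) / (4 * 2 ^ k)) := by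
    rw [zpow_sub₀ two_ne_zero, zpow_sub₀ two_ne_zero, zpow_neg, zpow_natCast, zpow_natCast,
      zpow_one, pow_add, pow_add]
    field_simp
    ring
  rw [hexp]
  have hG : 0 ≤ RPA.gaussBinom (l + r) k ^ d :=
    pow_nonneg (zero_le_one.trans (RPA.one_le_gaussBinom (by nlinarith))) _
  have hN : ((d : ℝ) + 2) * 2 ^ (l + r) ≤ 64 * (2 ^ (l + r)) ^ 3 := by
    have hdN : (d : ℝ) ≤ 2 ^ (l + r) := by
      have h1 : d < 2 ^ d := Nat.lt_two_pow_self
      have h2 : 2 ^ d ≤ 2 ^ (l + r) := Nat.pow_le_pow_right (by norm_num) (by nlinarith)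
      exact_mod_cast h1.le.trans h2
    have h1N : (1 : ℝ) ≤ 2 ^ (l + r) := one_le_pow₀ (by norm_num)
    set N : ℝ := 2 ^ (l + r)
    have h2N : N ≤ N ^ 2 := by nlinarith
    calc ((d : ℝ) + 2) * N ≤ (64 * N ^ 2) * N := by
          gcongr
          linarith
      _ = 64 * N ^ 3 := by ring
  calc _ = ((d : ℝ) + 2) * 2 ^ (l + r) * (RPA.gaussBinom (l + r) k ^ d * _) := by ring
    _ ≤ 64 * (2 ^ (l + r)) ^ 3 * (RPA.gaussBinom (l + r) k ^ d * _) :=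
        mul_le_mul_of_nonneg_right hN (mul_nonneg hG (Real.exp_pos _).le)
    _ = _ := by ring
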